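/- All graphs are finite, simple and undirected, and not necessarily connected. A connected cover in a graph $G$ is a finite family $\mathcal F=\{G_1,\dots,G_n\}$ (repetitions allowed, $n\ge 0$) of non-empty induced subgraphs of $G$ such that for every non-empty $\sigma\subseteq\{1,\dots,n\}$ the intersection $G_\sigma=\bigcap_{i\in\sigma}G_i$ is either empty or connected. Its nerve $N(\mathcal F)$ is the simplicial complex consisting of $\emptyset$ and all non-empty $\sigma\subseteq\{1,\dots,n\}$ with $G_\sigma\neq\emptyset$. Let $\tilde H_d$ denote reduced simplicial homology with coefficients in $\mathbb Z_2$. The homological dimension $\gamma(G)$ is the greatest integer $d$ such that $\tilde H_d(N(\mathcal F))\neq 0$ for some connected cover $\mathcal F$ in $G$. (The empty family has $\tilde H_{-1}\ne 0$, so that $\gamma(K_1)=-1$.) Theorem. Let $G$ be a planar graph. Then $\gamma(G)$ exists and $\gamma(G)\le 2$. Moreover, $\tilde H_3(N(\mathcal F))=0$ for every connected cover $\mathcal F$ in $G$. -/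

import Mathlib

namespace ConnectedCover

/-! ### Planar graphs -/

/-- A drawing of the graph `G` in the Euclidean plane. Vertices are distinct points; every edge `uv`
is a simple arc (the range of an injective path) joining the points `u` and `v`; an arc contains no
vertex other than its two ends; two different arcs meet only in common ends. -/
structure PlaneDrawing {V : Type*} (G : SimpleGraph V) where
  /-- the point representing a vertex -/
  point : V → EuclideanSpace ℝ (Fin 2)
  /-- the arc representing an edge -/
  arc : G.edgeSet → Set (EuclideanSpace ℝ (Fin 2))
  point_injective : Function.Injective point
  exists_path : ∀ (u v : V) (h : G.Adj u v), ∃ p : Path (point u) (point v),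
    Function.Injective p ∧ Set.range p = arc ⟨s(u, v), h⟩
  vertex_on_arc : ∀ (e : G.edgeSet) (w : V), point w ∈ arc e → w ∈ (e : Sym2 V)
  arcs_meet : ∀ e f : G.edgeSet, e ≠ f →
    arc e ∩ arc f ⊆ point '' {w | w ∈ (e : Sym2 V) ∧ w ∈ (f : Sym2 V)}

/-- A graph is planar if it can be drawn in the plane without crossings. -/
def IsPlanar {V : Type*} (G : SimpleGraph V) : Prop := Nonempty (PlaneDrawing G)

/-! ### Reduced simplicial homology with coefficients in `ℤ/2` -/

/-- The mod 2 boundary of a simplex is the sum of its facets. It is extended linearly to all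
formal sums of finite sets. A singleton has boundary `∅` (the augmentation), and `∅` has
boundary `0`. -/
noncomputable def boundary (ι : Type*) [DecidableEq ι] :
    (Finset ι →₀ ZMod 2) →ₗ[ZMod 2] (Finset ι →₀ ZMod 2) :=
  Finsupp.linearCombination (ZMod 2) fun σ => ∑ v ∈ σ, Finsupp.single (σ.erase v) 1

/-- The `d`-simplices of `K` are its faces with `d + 1` elements. The empty set, which Mathlib's
complexes do not list as a face, is the only simplex of dimension `-1`. -/
def simplices {ι : Type*} (K : PreAbstractSimplicialComplex ι) (d : ℤ) : Set (Finset ι) :=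
  {σ | (σ = ∅ ∨ σ ∈ K) ∧ (σ.card : ℤ) = d + 1}

/-- `C_d(K)` -/
noncomputable def chains {ι : Type*} (K : PreAbstractSimplicialComplex ι) (d : ℤ) :
    Submodule (ZMod 2) (Finset ι →₀ ZMod 2) :=
  Finsupp.supported (ZMod 2) (ZMod 2) (simplices K d)

/-- `Z_d(K)` -/
noncomputable def cycles {ι : Type*} [DecidableEq ι] (K : PreAbstractSimplicialComplex ι) (d : ℤ) :
    Submodule (ZMod 2) (Finset ι →₀ ZMod 2) :=
  chains K d ⊓ LinearMap.ker (boundary ι)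

/-- `B_d(K)` -/
noncomputable def boundaries {ι : Type*} [DecidableEq ι] (K : PreAbstractSimplicialComplex ι)
    (d : ℤ) : Submodule (ZMod 2) (Finset ι →₀ ZMod 2) :=
  (chains K (d + 1)).map (boundary ι)

theorem boundary_single {ι : Type*} [DecidableEq ι] (σ : Finset ι) (a : ZMod 2) :
    boundary ι (Finsupp.single σ a) = a • ∑ v ∈ σ, Finsupp.single (σ.erase v) 1 := by
  simp [boundary]

theorem boundary_boundary {ι : Type*} [DecidableEq ι] (c : Finset ι →₀ ZMod 2) :
    boundary ι (boundary ι c) = 0 := by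
  suffices h : (boundary ι).comp (boundary ι) = 0 from LinearMap.congr_fun h c
  refine Finsupp.lhom_ext' fun σ => LinearMap.ext_ring ?_
  have h2 : ∀ x : Finset ι →₀ ZMod 2, x + x = 0 := fun x => by
    rw [← two_smul (ZMod 2) x, show (2 : ZMod 2) = 0 from rfl, zero_smul]
  simp only [LinearMap.comp_apply, Finsupp.lsingle_apply, boundary_single, one_smul, map_sum,
    LinearMap.zero_apply]
  rw [Finset.sum_sigma']
  refine Finset.sum_involution (fun p _ => ⟨p.2, p.1⟩) ?_ ?_ ?_ ?_
  · intro p _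
    simp only
    rw [Finset.erase_right_comm]
    exact h2 _
  · intro p hp _ h
    simp only [Finset.mem_sigma, Finset.mem_erase] at hp
    exact hp.2.1 (congrArg Sigma.fst h)
  · intro p hp
    simp only [Finset.mem_sigma, Finset.mem_erase] at hp ⊢
    exact ⟨hp.2.2, fun h => hp.2.1 h.symm, hp.1⟩
  · intro p _
    rfl

theorem boundaries_le_cycles {ι : Type*} [DecidableEq ι] (K : PreAbstractSimplicialComplex ι)
    (d : ℤ) : boundaries K d ≤ cycles K d := by
  rintro _ ⟨c, hc, rfl⟩
  refine ⟨?_, boundary_boundary c⟩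
  have hle : chains K (d + 1) ≤ (chains K d).comap (boundary ι) := by
    rw [chains, Finsupp.supported_eq_span_single, Submodule.span_le]
    rintro _ ⟨σ, ⟨hσ, hcard⟩, rfl⟩
    simp only [Submodule.comap_coe, Set.mem_preimage, boundary_single, one_smul, SetLike.mem_coe]
    refine Submodule.sum_mem _ fun v hv => Finsupp.single_mem_supported _ _ ⟨?_, ?_⟩
    · rcases Finset.eq_empty_or_nonempty (σ.erase v) with h | h
      · exact Or.inl h
      · rcases hσ with rfl | hσ
        · simp at hv
        · exact Or.inr ((K.isRelLowerSet_faces hσ).2 (Finset.erase_subset v σ) h)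
    · have := Finset.card_erase_add_one hv
      omega
  exact hle hc

/-- The reduced homology group `H̃_d(K; ℤ/2) = Z_d(K) / B_d(K)`. -/
abbrev ReducedHomology {ι : Type*} [DecidableEq ι] (K : PreAbstractSimplicialComplex ι) (d : ℤ) :=
  (cycles K d).toAddSubgroup ⧸
    (boundaries K d).toAddSubgroup.addSubgroupOf (cycles K d).toAddSubgroup

/-! ### Connected covers and the homological dimension -/

/-- The nerve of a family of sets: its faces are the (non-empty) finite sets of indices for which
the corresponding members have a common element. -/
def nerve {ι V : Type*} (F : ι → Set V) : PreAbstractSimplicialComplex ι where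
  faces := {σ | σ.Nonempty ∧ (⋂ i ∈ σ, F i).Nonempty}
  isRelLowerSet_faces := fun _ hσ =>
    ⟨hσ.1, fun _ hτσ hτ => ⟨hτ, hσ.2.mono (Set.biInter_subset_biInter_left hτσ)⟩⟩

/-- A connected cover in `G`, as a family of induced subgraphs `G[F i]` given by their vertex sets.
Since the intersection of induced subgraphs is induced by the intersection of their vertex sets,
`G_σ` is the subgraph induced by `⋂ i ∈ σ, F i`. -/
structure IsConnectedCover {V ι : Type*} (G : SimpleGraph V) (F : ι → Set V) : Prop where
  nonempty : ∀ i, (F i).Nonempty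
  connected : ∀ σ ∈ nerve F, (G.induce (⋂ i ∈ σ, F i)).Connected

/-- All degrees `d` in which the nerve of some finite connected cover in `G` has non-zero reduced
homology. The empty family has nerve `{∅}`, with `H̃₋₁ ≠ 0`; so `-1` always occurs, and it is
the only degree for the graph with one vertex. -/
def nonvanishingDegrees {V : Type*} (G : SimpleGraph V) : Set ℤ :=
  {d | ∃ (n : ℕ) (F : Fin n → Set V), IsConnectedCover G F ∧
    Nontrivial (ReducedHomology (nerve F) d)}

/-- The homological dimension `γ(G)`. -/
noncomputable def homologicalDimension {V : Type*} (G : SimpleGraph V) : ℤ :=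
  sSup (nonvanishingDegrees G)

end ConnectedCover

/-! A finite planar graph is a minor of the square grid (`exists_grid_model`). Replacing each vertex
by its branch set turns a connected cover into a family of finite subsets `F i` of the grid, with
the same nerve and with connected or empty intersections `F_σ`. It remains to bound cycles in the
nerve of such a family (`cyclesBound_nerve_grid`), by induction on the size of `U = ⋃ F i`.

If some `F_σ` separates two points of `U`, the family is cut along `F_σ` into two families with
smaller unions. Their nerves cover the old nerve and meet in a cone, so Mayer–Vietoris
(`CyclesBound.union`) applies.

If nothing separates `U`, let `B i` consist of the components of the complement of `F i` that meet
`U`. The complements of the `B i` are the sets `F i` with the other components filled in. They have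
the same nerve as the `F i`, and a 1-cycle inside `F_σ` bounds a 2-chain avoiding all `B i`, `i ∈
σ`. A zigzag through the double complex of simplicial and grid chains
(`cyclesBound_nerve_of_complements`) lifts a cycle on `k`-element faces to 0-, 1- and 2-chains
indexed by faces with `k`, `k - 1` and `k - 2` elements. The obstruction left at indices with `k -
3` elements is a 2-cycle, hence constant on the grid, and it vanishes near `B j` for any `j` in the
index. This needs `k - 3 ≥ 1`, that is, degree at least 3. For `k = 3` the constant, the fundamental
class of the sphere, is not excluded. -/

namespace ConnectedCover

/-! ### Mod 2 simplicial chains: cones and Mayer–Vietoris. -/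

section Chains
theorem add_self_zmod_two (x : ZMod 2) : x + x = 0 := CharTwo.add_self_eq_zero x

variable {ι : Type*} [DecidableEq ι]

/-- The cone with apex `m` over a chain. -/
def cone (m : ι) (a : Finset ι → ZMod 2) (σ : Finset ι) : ZMod 2 :=
  if m ∈ σ then a (σ.erase m) else 0

theorem cone_ne_zero {m : ι} {a : Finset ι → ZMod 2} {σ : Finset ι} (h : cone m a σ ≠ 0) :
    m ∈ σ ∧ a (σ.erase m) ≠ 0 := by
  unfold cone at h
  split_ifs at h with hm
  · exact ⟨hm, h⟩
  · exact absurd rfl h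

variable [Fintype ι]

/-- The simplicial boundary of a mod 2 chain, given by its coefficients in a commutative monoid. -/
def bd {M : Type*} [AddCommMonoid M] (a : Finset ι → M) (ρ : Finset ι) : M :=
  ∑ i ∈ ρᶜ, a (insert i ρ)

theorem boundary_apply (c : Finset ι →₀ ZMod 2) (ρ : Finset ι) :
    boundary ι c ρ = bd (fun σ => c σ) ρ := by
  induction c using Finsupp.induction_linear with
  | zero => simp [bd]
  | add f g hf hg => simp [hf, hg, bd, Finset.sum_add_distrib]
  | single σ a =>
    rw [boundary_single]
    simp only [Finsupp.smul_apply, Finsupp.finsetSum_apply, smul_eq_mul, bd, Finsupp.single_apply]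
    by_cases h : ∃ i ∉ ρ, insert i ρ = σ
    · obtain ⟨i, hi, rfl⟩ := h
      rw [Finset.sum_eq_single i, Finset.sum_eq_single i]
      · simp [Finset.erase_insert hi]
      · intro j hj hji
        rw [if_neg]
        intro h
        have : i ∈ insert j ρ := h ▸ Finset.mem_insert_self i ρ
        simp [hi, Ne.symm hji] at this
      · simp [hi]
      · intro j hj hji
        rw [if_neg]
        intro h
        have : j ∈ ρ := by simpa [hji] using hj
        rw [← h] at this
        simp at this
      · simp
    · push Not at h
      rw [Finset.sum_eq_zero, Finset.sum_eq_zero, mul_zero]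
      · intro i hi
        rw [if_neg fun e => h i (by simpa using hi) e.symm]
      · intro i hi
        rw [if_neg fun e => h i (by simp [← e]) (by rw [← e, Finset.insert_erase hi])]

theorem bd_add {M : Type*} [AddCommMonoid M] (a b : Finset ι → M) (ρ : Finset ι) :
    bd (fun σ => a σ + b σ) ρ = bd a ρ + bd b ρ :=
  Finset.sum_add_distrib

theorem bd_apply {X M : Type*} [AddCommMonoid M] (a : Finset ι → X → M) (ρ : Finset ι) (x : X) :
    bd a ρ x = bd (fun σ => a σ x) ρ := by
  simp [bd]

theorem map_bd {M N : Type*} [AddCommMonoid M] [AddCommMonoid N] (φ : M →+ N) (a : Finset ι → M)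
    (ρ : Finset ι) : φ (bd a ρ) = bd (fun σ => φ (a σ)) ρ := by
  simp [bd]

theorem exists_of_bd_ne_zero {M : Type*} [AddCommMonoid M] {a : Finset ι → M} {ρ : Finset ι}
    (h : bd a ρ ≠ 0) : ∃ i ∉ ρ, a (insert i ρ) ≠ 0 := by
  obtain ⟨i, hi, h⟩ := Finset.exists_ne_zero_of_sum_ne_zero h
  exact ⟨i, by simpa using hi, h⟩

theorem bd_bd (a : Finset ι → ZMod 2) (ρ : Finset ι) : bd (bd a) ρ = 0 := by
  have h := boundary_boundary (Finsupp.equivFunOnFinite.symm a)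
  have h2 := DFunLike.congr_fun h ρ
  rw [boundary_apply] at h2
  simpa [boundary_apply] using h2

/-- The usual formula for the boundary of a cone. It needs no assumption that `m` is absent from
`a`: simplices through `m` do not enter the cone, and the term `i = m` of `bd a (ρ.erase m)`
accounts for them. -/
theorem bd_cone (m : ι) (a : Finset ι → ZMod 2) (ρ : Finset ι) :
    bd (cone m a) ρ = a ρ + cone m (bd a) ρ := by
  by_cases hm : m ∈ ρ
  · have h1 : cone m (bd a) ρ = a ρ + ∑ i ∈ ρᶜ, a (insert i (ρ.erase m)) := by
      rw [cone, if_pos hm, bd, Finset.compl_erase, Finset.sum_insert (by simpa using hm),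
        Finset.insert_erase hm]
    rw [h1, ← add_assoc, add_self_zmod_two, zero_add, bd]
    refine Finset.sum_congr rfl fun i hi => ?_
    have : i ≠ m := by rintro rfl; simp [hm] at hi
    rw [cone, if_pos (Finset.mem_insert_of_mem hm), Finset.erase_insert_of_ne this]
  · rw [cone, if_neg hm, add_zero, bd, Finset.sum_eq_single m]
    · simp [cone, Finset.erase_insert hm]
    · intro i _ hi
      simp [cone, hm, Ne.symm hi]
    · simp [hm]

theorem bd_cone_of_cycle (m : ι) {a : Finset ι → ZMod 2} (ha : ∀ ρ, bd a ρ = 0)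
    (ρ : Finset ι) : bd (cone m a) ρ = a ρ := by
  rw [bd_cone]
  simp [cone, ha]

open Classical in
/-- A chain filling the cycle `a`: the cone over `a` from a vertex of its support. -/
noncomputable def fill (a : Finset ι → ZMod 2) : Finset ι → ZMod 2 :=
  if h : ∃ m : ι, ∃ σ, a σ ≠ 0 ∧ m ∈ σ then cone h.choose a else 0

/-- The condition at `∅` excludes the cycle consisting of the empty simplex alone, which offers no
vertex as an apex. -/
theorem bd_fill {a : Finset ι → ZMod 2} (h0 : a ∅ = 0) (ha : ∀ ρ, bd a ρ = 0)
    (ρ : Finset ι) : bd (fill a) ρ = a ρ := by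
  unfold fill
  split_ifs with h
  · exact bd_cone_of_cycle _ ha ρ
  · push Not at h
    have : a ρ = 0 := by
      by_contra hρ
      rcases ρ.eq_empty_or_nonempty with rfl | ⟨m, hm⟩
      · exact hρ h0
      · exact h m ρ hρ hm
    simp [bd, this]

/-- Since the apex is a vertex of the support of `a`, filling introduces no new vertices. This keeps
fillings inside the prescribed subspaces of the double complex. -/
theorem fill_ne_zero {a : Finset ι → ZMod 2} {σ : Finset ι} (h : fill a σ ≠ 0) :
    (∃ τ, a τ ≠ 0 ∧ σ.card = τ.card + 1) ∧ ∀ i ∈ σ, ∃ τ, a τ ≠ 0 ∧ i ∈ τ := by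
  unfold fill at h
  split_ifs at h with hm
  · have h2 := cone_ne_zero h
    refine ⟨⟨_, h2.2, (Finset.card_erase_add_one h2.1).symm⟩, fun i hi => ?_⟩
    by_cases him : i = hm.choose
    · rw [him]; exact hm.choose_spec
    · exact ⟨_, h2.2, Finset.mem_erase.2 ⟨him, hi⟩⟩
  · exact absurd rfl h

/-- Every mod 2 cycle whose simplices belong to `K` and have `k` vertices is a boundary in `K`. -/
def CyclesBound (K : Set (Finset ι)) (k : ℕ) : Prop :=
  ∀ z : Finset ι → ZMod 2, (∀ σ, z σ ≠ 0 → σ ∈ K ∧ σ.card = k) → (∀ ρ, bd z ρ = 0) →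
    ∃ y : Finset ι → ZMod 2, (∀ σ, y σ ≠ 0 → σ ∈ K ∧ σ.card = k + 1) ∧ ∀ ρ, bd y ρ = z ρ

theorem CyclesBound.of_cone {K : Set (Finset ι)} {k : ℕ} (m : ι)
    (h : ∀ σ ∈ K, insert m σ ∈ K) : CyclesBound K k := by
  refine fun z hz hz0 => ⟨cone m z, fun σ hσ => ?_, bd_cone_of_cycle m hz0⟩
  have h2 := cone_ne_zero hσ
  have h3 := hz _ h2.2
  refine ⟨Finset.insert_erase h2.1 ▸ h _ h3.1, ?_⟩
  rw [← h3.2, Finset.card_erase_add_one h2.1]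

/-- Mayer–Vietoris when the intersection is a cone with apex `m`. Closure under facets is asked only
for simplices with `k` vertices, because a nerve does not contain `∅`. -/
theorem CyclesBound.union {K K₁ K₂ : Set (Finset ι)} {k : ℕ} (m : ι) (hK : K = K₁ ∪ K₂)
    (hm : ∀ σ ∈ K₁ ∩ K₂, insert m σ ∈ K₁ ∩ K₂)
    (hd₁ : ∀ σ ∈ K₁, ∀ i ∈ σ, σ.card = k → σ.erase i ∈ K₁)
    (hd₂ : ∀ σ ∈ K₂, ∀ i ∈ σ, σ.card = k → σ.erase i ∈ K₂)
    (h₁ : CyclesBound K₁ k) (h₂ : CyclesBound K₂ k) : CyclesBound K k := by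
  classical
  intro z hz hz0
  set z₁ : Finset ι → ZMod 2 := fun σ => if σ ∈ K₁ then z σ else 0 with hz₁
  set z₂ : Finset ι → ZMod 2 := fun σ => if σ ∈ K₁ then 0 else z σ with hz₂
  have hz12 : ∀ σ, z σ = z₁ σ + z₂ σ := fun σ => by simp only [hz₁, hz₂]; split_ifs <;> simp
  have hs₁ : ∀ σ, z₁ σ ≠ 0 → σ ∈ K₁ ∧ σ.card = k := fun σ h => by
    simp only [hz₁] at h
    split_ifs at h with h1
    · exact ⟨h1, (hz σ h).2⟩
    · exact absurd rfl h
  have hs₂ : ∀ σ, z₂ σ ≠ 0 → σ ∈ K₂ ∧ σ.card = k := fun σ h => by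
    simp only [hz₂] at h
    split_ifs at h with h1
    · exact absurd rfl h
    · have := hz σ h
      rw [hK] at this
      exact ⟨this.1.resolve_left h1, this.2⟩
  have hbd : ∀ ρ, bd z₁ ρ = bd z₂ ρ := fun ρ => by
    have := hz0 ρ
    rw [show z = fun σ => z₁ σ + z₂ σ from funext hz12, bd_add] at this
    exact CharTwo.add_eq_zero.1 this
  -- The common boundary of `z₁` and `z₂` lies in the intersection, so it is filled there by coning.
  -- Adding `w` to both halves makes each a cycle without changing their sum.
  set w := cone m (bd z₁) with hw
  have hbw : ∀ ρ, bd w ρ = bd z₁ ρ := bd_cone_of_cycle m (bd_bd z₁)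
  have hsw : ∀ σ, w σ ≠ 0 → σ ∈ K₁ ∩ K₂ ∧ σ.card = k := fun σ h => by
    obtain ⟨hmσ, h⟩ := cone_ne_zero h
    obtain ⟨i, hi, h1⟩ := exists_of_bd_ne_zero h
    obtain ⟨j, hj, h2⟩ := exists_of_bd_ne_zero (hbd _ ▸ h)
    have h1 := hs₁ _ h1
    have h2 := hs₂ _ h2
    have e1 := hd₁ _ h1.1 i (Finset.mem_insert_self _ _) h1.2
    have e2 := hd₂ _ h2.1 j (Finset.mem_insert_self _ _) h2.2
    rw [Finset.erase_insert hi] at e1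
    rw [Finset.erase_insert hj] at e2
    refine ⟨Finset.insert_erase hmσ ▸ hm _ ⟨e1, e2⟩, ?_⟩
    rw [← h1.2, Finset.card_insert_of_notMem hi, Finset.card_erase_add_one hmσ]
  obtain ⟨y₁, hy₁, hb₁⟩ := h₁ (fun σ => z₁ σ + w σ) (fun σ h => by
    by_cases hzσ : z₁ σ = 0
    · have := hsw σ (by simpa [hzσ] using h)
      exact ⟨this.1.1, this.2⟩
    · exact hs₁ σ hzσ) (fun ρ => by rw [bd_add, hbw, add_self_zmod_two])
  obtain ⟨y₂, hy₂, hb₂⟩ := h₂ (fun σ => z₂ σ + w σ) (fun σ h => by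
    by_cases hzσ : z₂ σ = 0
    · have := hsw σ (by simpa [hzσ] using h)
      exact ⟨this.1.2, this.2⟩
    · exact hs₂ σ hzσ) (fun ρ => by rw [bd_add, hbw, hbd, add_self_zmod_two])
  refine ⟨fun σ => y₁ σ + y₂ σ, fun σ h => ?_, fun ρ => ?_⟩
  · rw [hK]
    by_cases hyσ : y₁ σ = 0
    · have := hy₂ σ (by simpa [hyσ] using h)
      exact ⟨Or.inr this.1, this.2⟩
    · exact ⟨Or.inl (hy₁ σ hyσ).1, (hy₁ σ hyσ).2⟩
  · rw [bd_add, hb₁, hb₂, hz12]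
    linear_combination add_self_zmod_two (w ρ)

/-- Here `k` counts vertices, one more than the dimension. With `k` positive, the empty simplex
plays no part in the cycles. -/
theorem subsingleton_reducedHomology {K : PreAbstractSimplicialComplex ι} {k : ℕ} {d : ℤ}
    (hk : 0 < k) (hd : (k : ℤ) = d + 1) (h : CyclesBound {σ | σ ∈ K} k) :
    Subsingleton (ReducedHomology K d) := by
  refine QuotientAddGroup.subsingleton_iff.2 (eq_top_iff.2 ?_)
  rintro ⟨c, hc, hc0⟩ -
  rw [AddSubgroup.mem_addSubgroupOf]
  obtain ⟨y, hy, hb⟩ := h (fun σ => c σ) (fun σ hσ => by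
    have := (Finsupp.mem_supported _ _).1 hc (Finsupp.mem_support_iff.2 hσ)
    have hcard : σ.card = k := by have := this.2; omega
    refine ⟨this.1.resolve_left ?_, hcard⟩
    rintro rfl
    simp at hcard
    omega) (fun ρ => by
    rw [← boundary_apply]
    exact DFunLike.congr_fun (LinearMap.mem_ker.1 hc0) ρ)
  refine ⟨Finsupp.equivFunOnFinite.symm y, ?_, ?_⟩
  · refine (Finsupp.mem_supported _ _).2 fun σ hσ => ?_
    have := hy σ (by simpa using hσ)
    exact ⟨Or.inr this.1, by push_cast [this.2]; omega⟩
  · ext ρ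
    rw [boundary_apply]
    exact hb ρ

end Chains
-- Cellular chains of the square grid.
section Grid

/-- The square grid on `ℤ × ℤ`. -/
def grid : SimpleGraph (ℤ × ℤ) where
  Adj x y := (x.1 = y.1 ∧ (x.2 = y.2 + 1 ∨ y.2 = x.2 + 1)) ∨
    (x.2 = y.2 ∧ (x.1 = y.1 + 1 ∨ y.1 = x.1 + 1))
  symm := ⟨fun x y h => by omega⟩
  loopless := ⟨fun x h => by omega⟩

theorem grid_eq_univ {B : Set (ℤ × ℤ)} (hB : B.Nonempty)
    (h : ∀ x ∈ B, ∀ y, grid.Adj x y → y ∈ B) : B = Set.univ := by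
  obtain ⟨⟨a, b⟩, hab⟩ := hB
  have h1 : ∀ x : ℤ, (x, b) ∈ B := fun x => by
    induction x using Int.inductionOn' (b := a) with
    | zero => exact hab
    | succ k _ hk => exact h _ hk _ (by simp [grid])
    | pred k _ hk => exact h _ hk _ (by simp [grid])
  refine Set.eq_univ_of_forall fun ⟨x, y⟩ => ?_
  induction y using Int.inductionOn' (b := b) with
  | zero => exact h1 x
  | succ k _ hk => exact h _ hk _ (by simp [grid])
  | pred k _ hk => exact h _ hk _ (by simp [grid])

/-- An edge of the grid: `(false, x)` points from `x` to the right, `(true, x)` points up. -/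
abbrev GridEdge := Bool × (ℤ × ℤ)

/-- The second end of an edge of the grid. -/
def GridEdge.tip : GridEdge → ℤ × ℤ
  | (false, (a, b)) => (a + 1, b)
  | (true, (a, b)) => (a, b + 1)

/-- The edges of the grid with both ends in `A`. -/
def edgesIn (A : Set (ℤ × ℤ)) : Set GridEdge := {e | e.2 ∈ A ∧ e.tip ∈ A}

/-- The unit squares, given by their lower left corners, with all corners in `A`. -/
def squaresIn (A : Set (ℤ × ℤ)) : Set (ℤ × ℤ) :=
  {t | t ∈ A ∧ (t.1 + 1, t.2) ∈ A ∧ (t.1, t.2 + 1) ∈ A ∧ (t.1 + 1, t.2 + 1) ∈ A}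

/-- The boundary of a (possibly infinite) 1-chain of the grid. -/
def d₁ : (GridEdge → ZMod 2) →+ (ℤ × ℤ → ZMod 2) where
  toFun c x := c (false, x) + c (false, (x.1 - 1, x.2)) + c (true, x) + c (true, (x.1, x.2 - 1))
  map_zero' := by ext; simp
  map_add' c c' := by ext; simp; ring

/-- The boundary of a (possibly infinite) 2-chain of the grid. -/
def d₂ : (ℤ × ℤ → ZMod 2) →+ (GridEdge → ZMod 2) where
  toFun f e := if e.1 then f e.2 + f (e.2.1 - 1, e.2.2) else f e.2 + f (e.2.1, e.2.2 - 1)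
  map_zero' := by ext; simp
  map_add' c c' := by ext; simp; split_ifs <;> ring

theorem d₁_apply (c : GridEdge → ZMod 2) (a b : ℤ) : d₁ c (a, b) =
    c (false, (a, b)) + c (false, (a - 1, b)) + c (true, (a, b)) + c (true, (a, b - 1)) := rfl

theorem d₂_true (f : ℤ × ℤ → ZMod 2) (a b : ℤ) : d₂ f (true, (a, b)) = f (a, b) + f (a - 1, b) :=
  rfl

theorem d₂_false (f : ℤ × ℤ → ZMod 2) (a b : ℤ) :
    d₂ f (false, (a, b)) = f (a, b) + f (a, b - 1) := rfl

theorem d₁_d₂ (f : ℤ × ℤ → ZMod 2) : d₁ (d₂ f) = 0 := by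
  ext ⟨a, b⟩
  simp only [d₁_apply, d₂_true, d₂_false, Pi.zero_apply]
  linear_combination add_self_zmod_two (f (a, b)) + add_self_zmod_two (f (a, b - 1)) +
    add_self_zmod_two (f (a - 1, b)) + add_self_zmod_two (f (a - 1, b - 1))

theorem d₁_support {A : Set (ℤ × ℤ)} {c : GridEdge → ZMod 2} (hc : c.support ⊆ edgesIn A) :
    (d₁ c).support ⊆ A := by
  rintro ⟨a, b⟩ h
  by_contra hA
  have key : ∀ e : GridEdge, e.2 = (a, b) ∨ e.tip = (a, b) → c e = 0 := fun e he => by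
    by_contra hce
    have := hc hce
    rcases he with he | he
    · exact hA (he ▸ this.1)
    · exact hA (he ▸ this.2)
  apply h
  rw [d₁_apply, key (false, (a, b)) (Or.inl rfl), key (true, (a, b)) (Or.inl rfl),
    key (false, _) (Or.inr _),
    key (true, _) (Or.inr _)]
  · simp
  · simp [GridEdge.tip]
  · simp [GridEdge.tip]

theorem d₂_support {A : Set (ℤ × ℤ)} {f : ℤ × ℤ → ZMod 2} (hf : f.support ⊆ squaresIn A) :
    (d₂ f).support ⊆ edgesIn A := by
  rintro ⟨i, a, b⟩ h
  have key : ∀ t, f t ≠ 0 → t ∈ squaresIn A := fun t ht => hf ht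
  rcases i
  · have h : f (a, b) + f (a, b - 1) ≠ 0 := h
    by_cases h1 : f (a, b) = 0
    · have := key (a, b - 1) (by simpa [h1] using h)
      simp only [squaresIn, Set.mem_ofPred_eq, sub_add_cancel] at this
      exact ⟨this.2.2.1, this.2.2.2⟩
    · have := key _ h1
      exact ⟨this.1, this.2.1⟩
  · have h : f (a, b) + f (a - 1, b) ≠ 0 := h
    by_cases h1 : f (a, b) = 0
    · have := key (a - 1, b) (by simpa [h1] using h)
      simp only [squaresIn, Set.mem_ofPred_eq, sub_add_cancel] at this
      exact ⟨this.2.1, this.2.2.2⟩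
    · have := key _ h1
      exact ⟨this.1, this.2.2.1⟩

theorem finite_support_add {X : Type*} {a b : X → ZMod 2} (ha : a.support.Finite)
    (hb : b.support.Finite) : (a + b).support.Finite :=
  (ha.union hb).subset (Function.support_add a b)

theorem finite_support_d₁ {c : GridEdge → ZMod 2} (hc : c.support.Finite) :
    (d₁ c).support.Finite := by
  refine ((hc.image Prod.snd).union (hc.image GridEdge.tip)).subset (d₁_support fun e he => ?_)
  exact ⟨Or.inl ⟨e, he, rfl⟩, Or.inr ⟨e, he, rfl⟩⟩

/-- A 2-chain which is constant outside a finite set has a finite boundary. -/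
theorem finite_support_d₂ {f : ℤ × ℤ → ZMod 2} {s : ZMod 2} {Q : Set (ℤ × ℤ)} (hQ : Q.Finite)
    (hf : ∀ t ∉ Q, f t = s) : (d₂ f).support.Finite := by
  have h : d₂ f = d₂ (fun t => f t + s) := by
    ext ⟨i, a, b⟩
    rcases i
    · simp only [d₂_false]
      linear_combination - add_self_zmod_two s
    · simp only [d₂_true]
      linear_combination - add_self_zmod_two s
  rw [h]
  let T : Set (ℤ × ℤ) := ⋃ x ∈ ({(0, 0), (1, 0), (0, 1), (1, 1)} : Set (ℤ × ℤ)), (fun t => t + x) '' Q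
  have hT : T.Finite := Set.Finite.biUnion (by simp) fun x _ => hQ.image _
  refine (Set.finite_univ.prod hT).subset ((d₂_support (A := T) fun t ht => ?_).trans fun e he => ?_)
  · have : t ∈ Q := by
      by_contra htQ
      exact ht (by simp [hf t htQ, add_self_zmod_two])
    simp only [squaresIn, T, Set.mem_ofPred_eq, Set.mem_iUnion]
    exact ⟨⟨(0, 0), by simp, t, this, by simp⟩, ⟨(1, 0), by simp, t, this, by ext <;> simp⟩,
      ⟨(0, 1), by simp, t, this, by ext <;> simp⟩, ⟨(1, 1), by simp, t, this, by ext <;> simp⟩⟩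
  · exact ⟨trivial, he.1⟩

/-- The augmentation of a 0-chain. -/
noncomputable def aug {X : Type*} (p : X → ZMod 2) : ZMod 2 := ∑ᶠ x, p x

theorem aug_add {X : Type*} {p q : X → ZMod 2} (hp : p.support.Finite) (hq : q.support.Finite) :
    aug (p + q) = aug p + aug q :=
  finsum_add_distrib hp hq

theorem aug_comp_equiv {X : Type*} (e : X ≃ X) (p : X → ZMod 2) : aug (fun x => p (e x)) = aug p :=
  finsum_comp_equiv e

/-- The boundary is a sum of four functions which form two pairs of translates, and translates have
equal augmentation. -/
theorem aug_d₁ {c : GridEdge → ZMod 2} (hc : c.support.Finite) : aug (d₁ c) = 0 := by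
  have hfin : ∀ i : Bool, (fun x => c (i, x)).support.Finite := fun i =>
    (hc.preimage (Prod.mk_right_injective i).injOn).subset fun x hx => hx
  have hfin' : ∀ (i : Bool) (e : ℤ × ℤ ≃ ℤ × ℤ), (fun x => c (i, e x)).support.Finite := fun i e =>
    ((hfin i).preimage e.injective.injOn).subset fun x hx => hx
  let e₁ : ℤ × ℤ ≃ ℤ × ℤ := (Equiv.subRight 1).prodCongr (Equiv.refl ℤ)
  let e₂ : ℤ × ℤ ≃ ℤ × ℤ := (Equiv.refl ℤ).prodCongr (Equiv.subRight 1)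
  have h : d₁ c = (fun x => c (false, x)) + (fun x => c (false, e₁ x)) + (fun x => c (true, x)) +
    (fun x => c (true, e₂ x)) := rfl
  rw [h, aug_add (finite_support_add (finite_support_add (hfin _) (hfin' _ _)) (hfin _))
    (hfin' _ _), aug_add (finite_support_add (hfin _) (hfin' _ _)) (hfin _),
    aug_add (hfin _) (hfin' _ _), aug_comp_equiv e₁ (fun x => c (false, x)),
    aug_comp_equiv e₂ (fun x => c (true, x)), add_self_zmod_two, zero_add, add_self_zmod_two]

/-- Every finite 1-cycle of the grid bounds a finite 2-chain. -/
theorem exists_d₂_eq {z : GridEdge → ZMod 2} (hz : z.support.Finite) (h0 : d₁ z = 0) :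
    ∃ f : ℤ × ℤ → ZMod 2, f.support.Finite ∧ d₂ f = z := by
  have hbd : ∃ m : ℤ, ∀ i a b, z (i, (a, b)) ≠ 0 → |a| < m ∧ |b| < m := by
    obtain ⟨m₁, h₁⟩ := (hz.image fun e => |e.2.1|).bddAbove
    obtain ⟨m₂, h₂⟩ := (hz.image fun e => |e.2.2|).bddAbove
    refine ⟨max m₁ m₂ + 1, fun i a b h => ?_⟩
    have e₁ : |a| ≤ m₁ := h₁ ⟨(i, (a, b)), h, rfl⟩
    have e₂ : |b| ≤ m₂ := h₂ ⟨(i, (a, b)), h, rfl⟩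
    exact ⟨by omega, by omega⟩
  obtain ⟨m, hm⟩ := hbd
  have hm0 : ∀ i a b, m ≤ |a| ∨ m ≤ |b| → z (i, (a, b)) = 0 := fun i a b h => by
    by_contra hne
    have := hm i a b hne
    omega
  have hcyc : ∀ a b, z (false, (a, b)) + z (false, (a - 1, b)) =
      z (true, (a, b)) + z (true, (a, b - 1)) := fun a b => by
    have := congrFun h0 (a, b)
    rw [d₁_apply, Pi.zero_apply, add_assoc] at this
    exact CharTwo.add_eq_zero.1 this
  -- The coefficient of a square is the parity of the horizontal edges of `z` crossed by a downward
  -- ray. Horizontal edges are then correct by construction, and vertical ones by induction on the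
  -- height, using `d₁ z = 0`.
  let f : ℤ × ℤ → ZMod 2 := fun x => ∑ j ∈ Finset.Icc (-m) x.2, z (false, (x.1, j))
  have hlow : ∀ a b, b ≤ -m → f (a, b) = 0 := fun a b hb => Finset.sum_eq_zero fun j hj =>
    hm0 _ _ _ (Or.inr (by
      have := (Finset.mem_Icc.1 hj).2
      have := neg_le_abs j
      simp only at *
      omega))
  have hstep : ∀ a b, f (a, b) = f (a, b - 1) + z (false, (a, b)) := fun a b => by
    rcases lt_or_ge b (-m) with hb | hb
    · rw [hlow a b (by omega), hlow a (b - 1) (by omega), hm0]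
      · simp
      · right; have := neg_le_abs b; omega
    · have : Finset.Icc (-m) b = insert b (Finset.Icc (-m) (b - 1)) := by
        ext j; simp; omega
      simp only [f]
      rw [this, Finset.sum_insert (by simp), add_comm]
  have hvert : ∀ a b, f (a, b) + f (a - 1, b) = z (true, (a, b)) := fun a b => by
    rcases le_total b (-m) with hb | hb
    · rw [hlow _ _ hb, hlow _ _ hb, hm0]
      · simp
      · right; have := neg_le_abs b; omega
    · induction b, hb using Int.leInduction with
      | base =>
        rw [hlow _ _ le_rfl, hlow _ _ le_rfl, hm0]
        · simp
        · right; have := neg_le_abs (-m); omega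
      | succ b hb ih =>
        have h1 := hstep a (b + 1)
        have h2 := hstep (a - 1) (b + 1)
        have h3 := hcyc a (b + 1)
        rw [add_sub_cancel_right] at h1 h2 h3
        rw [h1, h2]
        linear_combination ih + h3 + add_self_zmod_two (z (true, (a, b)))
  have hhor : ∀ a b, m ≤ |a| → f (a, b) = 0 := fun a b ha => Finset.sum_eq_zero fun j _ =>
    hm0 _ _ _ (Or.inl ha)
  have hhigh : ∀ a b, m ≤ b → f (a, b) = 0 := fun a b hb => by
    have hs : ∀ a, f (a, b) = f (a - 1, b) := fun a => by
      rw [← CharTwo.add_eq_zero, hvert, hm0]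
      right; have := le_abs_self b; omega
    induction a using Int.inductionOn' (b := m) with
    | zero => exact hhor _ _ (le_abs_self m)
    | succ k _ ih => rw [hs, add_sub_cancel_right, ih]
    | pred k _ ih => rw [← hs, ih]
  refine ⟨f, ((Set.finite_Icc (-m) m).prod (Set.finite_Icc (-m) m)).subset ?_, ?_⟩
  · rintro ⟨a, b⟩ h
    have h1 : |a| < m := by by_contra hc; exact h (hhor a b (by omega))
    have h2 : b < m := by by_contra hc; exact h (hhigh a b (by omega))
    have h3 : -m < b := by by_contra hc; exact h (hlow a b (by omega))
    have := abs_lt.1 h1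
    simp only [Set.mem_prod, Set.mem_Icc]
    omega
  · ext ⟨i, a, b⟩
    rcases i
    · rw [d₂_false, hstep]
      linear_combination add_self_zmod_two (f (a, b - 1))
    · rw [d₂_true, hvert]

theorem eq_const_of_d₂_eq_zero {f : ℤ × ℤ → ZMod 2} (h : d₂ f = 0) (x y : ℤ × ℤ) : f x = f y := by
  have h1 : ∀ a b, f (a, b) = f (a - 1, b) := fun a b =>
    CharTwo.add_eq_zero.1 (congrFun h (true, (a, b)))
  have h2 : ∀ a b, f (a, b) = f (a, b - 1) := fun a b =>
    CharTwo.add_eq_zero.1 (congrFun h (false, (a, b)))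
  have : {z | f z = f y} = Set.univ := grid_eq_univ ⟨y, rfl⟩ fun ⟨a, b⟩ hx ⟨a', b'⟩ hadj => by
    simp only [grid] at hadj
    simp only [Set.mem_ofPred_eq] at hx ⊢
    rw [← hx]
    rcases hadj with ⟨rfl, rfl | rfl⟩ | ⟨rfl, rfl | rfl⟩
    · rw [h2 a (b' + 1), add_sub_cancel_right]
    · rw [h2 a (b + 1), add_sub_cancel_right]
    · rw [h1 (a' + 1) b, add_sub_cancel_right]
    · rw [h1 (a + 1) b, add_sub_cancel_right]
  exact this.ge (Set.mem_univ x)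

end Grid
-- Paths inside a vertex set and the chains they carry.
section Paths
variable {V : Type*}

/-- `x` and `y` are joined by a path of `G` inside `A`. (Every `x` is joined to itself.) -/
def JoinedInside (G : SimpleGraph V) (A : Set V) : V → V → Prop :=
  Relation.ReflTransGen fun x y => G.Adj x y ∧ x ∈ A ∧ y ∈ A

/-- `A` induces a connected or empty subgraph of `G`. -/
def ConnectedInside (G : SimpleGraph V) (A : Set V) : Prop :=
  ∀ x ∈ A, ∀ y ∈ A, JoinedInside G A x y

variable {G : SimpleGraph V} {A B : Set V} {x y : V}

theorem JoinedInside.symm (h : JoinedInside G A x y) : JoinedInside G A y x :=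
  have : Std.Symm fun x y => G.Adj x y ∧ x ∈ A ∧ y ∈ A := ⟨fun _ _ h => ⟨h.1.symm, h.2.2, h.2.1⟩⟩
  Relation.ReflTransGen.stdSymm.symm _ _ h

theorem JoinedInside.mono (hAB : A ⊆ B) (h : JoinedInside G A x y) : JoinedInside G B x y :=
  Relation.ReflTransGen.mono (fun _ _ h => ⟨h.1, hAB h.2.1, hAB h.2.2⟩) _ _ h

theorem JoinedInside.mem (h : JoinedInside G A x y) (hx : x ∈ A) : y ∈ A := by
  induction h with
  | refl => exact hx
  | tail _ h _ => exact h.2.2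

end Paths

section GridPaths

theorem d₁_single (e : GridEdge) : d₁ (Pi.single e 1) = Pi.single e.2 1 + Pi.single e.tip 1 := by
  obtain ⟨i, a, b⟩ := e
  ext ⟨x, y⟩
  rcases i
  · have : (x - 1 = a) ↔ x = a + 1 := by omega
    simp [d₁_apply, GridEdge.tip, Pi.single_apply, this]
  · have : (y - 1 = b) ↔ y = b + 1 := by omega
    simp [d₁_apply, GridEdge.tip, Pi.single_apply, this]

theorem exists_edge_of_adj {x y : ℤ × ℤ} (h : grid.Adj x y) :
    ∃ e : GridEdge, (e.2 = x ∧ e.tip = y) ∨ (e.2 = y ∧ e.tip = x) := by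
  obtain ⟨a, b⟩ := x
  obtain ⟨a', b'⟩ := y
  simp only [grid] at h
  rcases h with ⟨rfl, rfl | rfl⟩ | ⟨rfl, rfl | rfl⟩
  · exact ⟨(true, _), Or.inr ⟨rfl, rfl⟩⟩
  · exact ⟨(true, _), Or.inl ⟨rfl, rfl⟩⟩
  · exact ⟨(false, _), Or.inr ⟨rfl, rfl⟩⟩
  · exact ⟨(false, _), Or.inl ⟨rfl, rfl⟩⟩

variable {A : Set (ℤ × ℤ)}

theorem support_add_subset {X : Type*} {S : Set X} {a b : X → ZMod 2} (ha : a.support ⊆ S)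
    (hb : b.support ⊆ S) : (a + b).support ⊆ S :=
  (Function.support_add a b).trans (Set.union_subset ha hb)

theorem JoinedInside.exists_chain {x y : ℤ × ℤ} (h : JoinedInside grid A x y) :
    ∃ c : GridEdge → ZMod 2, c.support.Finite ∧ c.support ⊆ edgesIn A ∧
      d₁ c = Pi.single x 1 + Pi.single y 1 := by
  induction h with
  | refl =>
    refine ⟨0, by simp, by simp, ?_⟩
    rw [map_zero, CharTwo.add_self_eq_zero]
  | @tail y z _ hyz ih =>
    obtain ⟨c, hc, hcA, hd⟩ := ih
    obtain ⟨e, he⟩ := exists_edge_of_adj hyz.1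
    refine ⟨c + Pi.single e 1, finite_support_add hc ((Set.finite_singleton e).subset
      Pi.support_single_subset), support_add_subset hcA (Pi.support_single_subset.trans ?_), ?_⟩
    · rw [Set.singleton_subset_iff]
      rcases he with he | he
      · exact ⟨he.1 ▸ hyz.2.1, he.2 ▸ hyz.2.2⟩
      · exact ⟨he.1 ▸ hyz.2.2, he.2 ▸ hyz.2.1⟩
    · have h2 : d₁ (Pi.single e 1) = Pi.single y 1 + Pi.single z 1 := by
        rw [d₁_single]
        rcases he with ⟨h1, h2⟩ | ⟨h1, h2⟩
        · rw [h1, h2]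
        · rw [h1, h2, add_comm]
      rw [map_add, hd, h2, add_assoc, ← add_assoc (Pi.single y 1) (Pi.single y 1),
        CharTwo.add_self_eq_zero, zero_add]

theorem aug_single {X : Type*} [DecidableEq X] (x : X) (s : ZMod 2) : aug (Pi.single x s) = s := by
  rw [aug, finsum_eq_single _ x fun y hy => by simp [hy], Pi.single_eq_same]

/-- Each point of the support is moved to a base point `o` along a path in `A`. What accumulates at
`o` is the augmentation, which is zero. -/
theorem ConnectedInside.exists_chain (hA : ConnectedInside grid A) {p : ℤ × ℤ → ZMod 2}
    (hp : p.support.Finite) (hpA : p.support ⊆ A) (h0 : aug p = 0) :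
    ∃ c : GridEdge → ZMod 2, c.support.Finite ∧ c.support ⊆ edgesIn A ∧ d₁ c = p := by
  rcases A.eq_empty_or_nonempty with rfl | ⟨o, ho⟩
  · exact ⟨0, by simp, by simp, by rw [map_zero, Function.support_eq_empty_iff.1
      (Set.subset_empty_iff.1 hpA)]⟩
  suffices h : ∀ s : Finset (ℤ × ℤ), ∀ p : ℤ × ℤ → ZMod 2, p.support ⊆ s → p.support ⊆ A →
      ∃ c : GridEdge → ZMod 2, c.support.Finite ∧ c.support ⊆ edgesIn A ∧
        d₁ c = p + Pi.single o (aug p) by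
    obtain ⟨c, h1, h2, h3⟩ := h hp.toFinset p (by simp) hpA
    exact ⟨c, h1, h2, by rw [h3, h0, Pi.single_zero, add_zero]⟩
  intro s
  induction s using Finset.induction_on with
  | empty =>
    intro p hp _
    rw [Finset.coe_empty, Set.subset_empty_iff, Function.support_eq_empty_iff] at hp
    subst hp
    exact ⟨0, by simp, by simp, by simp [aug]⟩
  | insert x s hx ih =>
    intro p hps hpA
    by_cases hpx : p x = 0
    · refine ih p (fun y hy => ?_) hpA
      have := hps hy
      rw [Finset.coe_insert] at this
      rcases this with rfl | h
      · exact absurd hpx hy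
      · exact h
    · have hx1 : p x = 1 := Fin.eq_one_of_ne_zero _ hpx
      have hfin : (Pi.single x (1 : ZMod 2) : ℤ × ℤ → ZMod 2).support.Finite :=
        (Set.finite_singleton x).subset Pi.support_single_subset
      obtain ⟨c, h1, h2, h3⟩ := ih (p + Pi.single x 1) (fun y hy => by
        by_cases hyx : y = x
        · subst hyx
          simp [hx1, add_self_zmod_two] at hy
        · have : p y ≠ 0 := by simpa [hyx] using hy
          simpa [hyx] using hps this)
        (support_add_subset hpA (Pi.support_single_subset.trans
          (Set.singleton_subset_iff.2 (hpA hpx))))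
      obtain ⟨c', h1', h2', h3'⟩ := (hA o ho x (hpA hpx)).exists_chain
      refine ⟨c + c', finite_support_add h1 h1', support_add_subset h2 h2', ?_⟩
      rw [map_add, h3, h3', aug_add (s.finite_toSet.insert x |>.subset (by simpa using hps)) hfin,
        aug_single, Pi.single_add]
      have e1 := CharTwo.add_self_eq_zero (Pi.single x 1 : ℤ × ℤ → ZMod 2)
      have e2 := CharTwo.add_self_eq_zero (Pi.single o 1 : ℤ × ℤ → ZMod 2)
      linear_combination (exp := 1) e1 + e2

/-- If `B` lies in one component of the complement of `A`, then every cycle inside `A` bounds a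
2-chain avoiding `B`. -/
theorem exists_d₂_eq_of_joined {B : Set (ℤ × ℤ)} (hBA : ∀ x ∈ B, x ∉ A)
    (hB : ∀ x ∈ B, ∀ y ∈ B, JoinedInside grid Aᶜ x y) {z : GridEdge → ZMod 2}
    (hz : z.support.Finite) (hzA : z.support ⊆ edgesIn A) (h0 : d₁ z = 0) :
    ∃ f : ℤ × ℤ → ZMod 2, (∃ Q : Set (ℤ × ℤ), Q.Finite ∧ ∃ s, ∀ t ∉ Q, f t = s) ∧
      f.support ⊆ squaresIn Bᶜ ∧ d₂ f = z := by
  obtain ⟨f, hf, hfz⟩ := exists_d₂_eq hz h0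
  rcases B.eq_empty_or_nonempty with rfl | ⟨o, ho⟩
  · exact ⟨f, ⟨_, hf, 0, fun t ht => by simpa using ht⟩, by simp [squaresIn], hfz⟩
  have hzero : ∀ e : GridEdge, e.2 ∉ A ∨ e.tip ∉ A → d₂ f e = 0 := fun e he => by
    by_contra h
    rw [hfz] at h
    have := hzA h
    exact he.elim (fun h => h this.1) fun h => h this.2
  -- The edges at a point outside `A` carry no coefficient of `z`, so `f` agrees on the four squares
  -- around that point. Hence `f` is constant along paths outside `A`.
  have h1 : ∀ a b, (a, b) ∉ A → f (a, b - 1) = f (a, b) := fun a b h =>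
    (CharTwo.add_eq_zero.1 (hzero (false, (a, b)) (Or.inl h))).symm
  have h2 : ∀ a b, (a, b) ∉ A → f (a - 1, b) = f (a, b) := fun a b h =>
    (CharTwo.add_eq_zero.1 (hzero (true, (a, b)) (Or.inl h))).symm
  have h3 : ∀ a b, (a, b) ∉ A → f (a - 1, b - 1) = f (a, b) := fun a b h => by
    rw [← h2 a b h]
    exact (CharTwo.add_eq_zero.1 (hzero (false, (a - 1, b))
      (Or.inr (by simpa [GridEdge.tip] using h)))).symm
  have hstep : ∀ x y, grid.Adj x y → x ∈ Aᶜ → y ∈ Aᶜ → f x = f y := by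
    rintro ⟨a, b⟩ ⟨a', b'⟩ hadj hx hy
    simp only [grid] at hadj
    rcases hadj with ⟨rfl, rfl | rfl⟩ | ⟨rfl, rfl | rfl⟩
    · rw [← h1 _ _ hx, add_sub_cancel_right]
    · rw [← h1 _ _ hy, add_sub_cancel_right]
    · rw [← h2 _ _ hx, add_sub_cancel_right]
    · rw [← h2 _ _ hy, add_sub_cancel_right]
  have hconst : ∀ x ∈ B, f x = f o := fun x hx => by
    have h := hB o ho x hx
    clear hx
    induction h with
    | refl => rfl
    | tail _ h ih => rw [← hstep _ _ h.1 h.2.1 h.2.2, ih]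
  -- Adding the constant `f o` leaves `d₂ f` unchanged and clears all squares touching `B`. The new
  -- chain may have infinite support, so only constancy off a finite set is claimed.
  refine ⟨fun t => f t + f o, ⟨_, hf, f o, fun t ht => ?_⟩, fun t ht => ?_, ?_⟩
  · have : f t = 0 := by simpa using ht
    simp [this]
  · obtain ⟨a, b⟩ := t
    have key : ∀ x ∈ B, f (a, b) ≠ f x := fun x hx h => by
      rw [hconst x hx] at h
      exact ht (by simp [h, add_self_zmod_two])
    refine ⟨fun h => key _ h rfl, fun h => key _ h ?_, fun h => key _ h ?_, fun h => key _ h ?_⟩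
    · have := h2 _ _ (hBA _ h); rwa [add_sub_cancel_right] at this
    · have := h1 _ _ (hBA _ h); rwa [add_sub_cancel_right] at this
    · have := h3 _ _ (hBA _ h); rwa [add_sub_cancel_right, add_sub_cancel_right] at this
  · rw [← hfz]
    ext ⟨i, a, b⟩
    rcases i
    · rw [d₂_false, d₂_false]; linear_combination add_self_zmod_two (f o)
    · rw [d₂_true, d₂_true]; linear_combination add_self_zmod_two (f o)

end GridPaths
-- The double complex of simplicial and grid chains.
section Zigzag
variable {ι : Type*} [Fintype ι]

theorem finite_support_of_imp {X : Type*} {a b : Finset ι → X → ZMod 2}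
    (ha : ∀ τ, (a τ).support.Finite) (h : ∀ σ x, b σ x ≠ 0 → ∃ τ, a τ x ≠ 0) (σ : Finset ι) :
    (b σ).support.Finite :=
  (Set.finite_iUnion ha).subset fun x hx => Set.mem_iUnion.2 (h σ x hx)

variable [DecidableEq ι]

/-- Exactness of the simplicial direction of the double complex of a family of subspaces: `R i x`
says that the cell `x` lies in the `i`-th subspace. -/
theorem exists_bd_eq {X : Type*} {R : ι → X → Prop} {k : ℕ} (hk : 0 < k)
    {a : Finset ι → X → ZMod 2} (ha : ∀ σ x, a σ x ≠ 0 → σ.card = k ∧ ∀ i ∈ σ, R i x)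
    (h0 : ∀ ρ, bd a ρ = 0) :
    ∃ b : Finset ι → X → ZMod 2, (∀ σ x, b σ x ≠ 0 → σ.card = k + 1 ∧ ∀ i ∈ σ, R i x) ∧
      (∀ ρ, bd b ρ = a ρ) ∧ (∀ σ x y, (∀ τ, a τ x = a τ y) → b σ x = b σ y) ∧
      ∀ σ x, b σ x ≠ 0 → ∃ τ, a τ x ≠ 0 := by
  -- For a fixed cell `x` the coefficients form a simplicial cycle on the full simplex with vertices
  -- `{i | R i x}`, which `fill` bounds. As `fill` depends only on that cycle, cells with equal
  -- coefficients get equal fillings.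
  refine ⟨fun σ x => fill (fun τ => a τ x) σ, fun σ x h => ?_, fun ρ => ?_, fun σ x y h => ?_,
    fun σ x h => ?_⟩
  · obtain ⟨⟨τ, hτ, hc⟩, h2⟩ := fill_ne_zero h
    refine ⟨by rw [hc, (ha τ x hτ).1], fun i hi => ?_⟩
    obtain ⟨τ, hτ, hi⟩ := h2 i hi
    exact (ha τ x hτ).2 i hi
  · ext x
    rw [bd_apply]
    refine bd_fill ?_ (fun ρ => ?_) ρ
    · by_contra h
      have := (ha _ _ h).1
      simp at this
      omega
    · rw [← bd_apply, h0, Pi.zero_apply]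
  · simp only [h]
  · obtain ⟨⟨τ, hτ, -⟩, -⟩ := fill_ne_zero h
    exact ⟨τ, hτ⟩

theorem finite_support_bd {X : Type*} {a : Finset ι → X → ZMod 2}
    (ha : ∀ τ, (a τ).support.Finite) (ρ : Finset ι) : (bd a ρ).support.Finite := by
  refine finite_support_of_imp (b := bd a) ha (fun σ x hx => ?_) ρ
  rw [bd_apply] at hx
  obtain ⟨i, _, h⟩ := exists_of_bd_ne_zero hx
  exact ⟨_, h⟩

theorem aug_bd {X : Type*} {a : Finset ι → X → ZMod 2} (ha : ∀ τ, (a τ).support.Finite)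
    (ρ : Finset ι) : aug (bd a ρ) = bd (fun σ => aug (a σ)) ρ := by
  unfold aug bd
  rw [← finsum_sum_comm _ _ fun i _ => ha _]
  simp

theorem bd_bd_cells {X : Type*} (a : Finset ι → X → ZMod 2) (ρ : Finset ι) : bd (bd a) ρ = 0 := by
  ext x
  rw [bd_apply]
  simp only [bd_apply]
  exact bd_bd _ ρ

/-- The nerve of a family of connected subsets of the grid has no homology above dimension two,
provided that every `F i` comes with a set `B i` in its complement such that the family of the
complements of the `B i` has the same nerve and simply connected intersections. -/
theorem cyclesBound_nerve_of_complements {k : ℕ} (hk : 4 ≤ k) {F B : ι → Set (ℤ × ℤ)}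
    (hF : ∀ σ : Finset ι, σ.Nonempty → ConnectedInside grid (⋂ i ∈ σ, F i))
    (hB : ∀ i, (B i).Nonempty) (hBF : ∀ i, ∀ x ∈ B i, x ∉ F i)
    (hBc : ∀ σ ∈ nerve F, ∀ x ∈ ⋃ i ∈ σ, B i, ∀ y ∈ ⋃ i ∈ σ, B i,
      JoinedInside grid (⋂ i ∈ σ, F i)ᶜ x y)
    (hBn : ∀ σ : Finset ι, σ.Nonempty → (∃ x, ∀ i ∈ σ, x ∉ B i) → (⋂ i ∈ σ, F i).Nonempty) :
    CyclesBound {σ | σ ∈ nerve F} k := by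
  classical
  intro z hz hz0
  have hpos : ∀ (σ : Finset ι) (m : ℕ), 0 < m → σ.card = m → σ.Nonempty := fun σ m hm h =>
    Finset.card_pos.1 (h ▸ hm)
  -- Descent: `z` lifts to 0-chains `P`, then `bd P = d₁ c` by connectedness and `bd c = d₂ f` by
  -- filling holes. Each lift is chosen to be zero where its data vanish, so that it stays on
  -- indices of the right cardinality.
  have hchain : ∀ σ, ∃ p : ℤ × ℤ → ZMod 2, p.support.Finite ∧ p.support ⊆ (⋂ i ∈ σ, F i) ∧
      aug p = z σ ∧ (z σ = 0 → p = 0) := fun σ => by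
    by_cases h : z σ = 0
    · exact ⟨0, by simp, by simp, by simp [aug, h], fun _ => rfl⟩
    · obtain ⟨x, hx⟩ := (hz σ h).1.2
      exact ⟨Pi.single x (z σ), (Set.finite_singleton x).subset Pi.support_single_subset,
        Pi.support_single_subset.trans (Set.singleton_subset_iff.2 hx), aug_single x _,
        fun h0 => absurd h0 h⟩
  choose P hPfin hPF hPaug hP0 using hchain
  have hPz : ∀ σ x, P σ x ≠ 0 → z σ ≠ 0 := fun σ x h h0 => h (by rw [hP0 σ h0, Pi.zero_apply])
  have hc : ∀ ρ, ∃ c : GridEdge → ZMod 2, c.support.Finite ∧ c.support ⊆ edgesIn (⋂ i ∈ ρ, F i) ∧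
      d₁ c = bd P ρ ∧ (c ≠ 0 → ρ.card + 1 = k) := fun ρ => by
    by_cases h : bd P ρ = 0
    · exact ⟨0, by simp, by simp, by simp [h], fun h => absurd rfl h⟩
    · obtain ⟨i, hi, h⟩ := exists_of_bd_ne_zero h
      have hcard : ρ.card + 1 = k := by
        rw [← Finset.card_insert_of_notMem hi]
        exact (hz _ fun h0 => h (hP0 _ h0)).2
      obtain ⟨c, h1, h2, h3⟩ := (hF ρ (hpos ρ (k - 1) (by omega) (by omega))).exists_chain
        (finite_support_bd hPfin ρ) (fun x hx => by
          have hx : bd P ρ x ≠ 0 := hx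
          rw [bd_apply] at hx
          obtain ⟨i, _, h⟩ := exists_of_bd_ne_zero hx
          exact Set.biInter_subset_biInter_left (Finset.subset_insert i ρ) (hPF _ h))
        (by rw [aug_bd hPfin]; simp only [hPaug]; exact hz0 ρ)
      exact ⟨c, h1, h2, h3, fun _ => hcard⟩
  choose c hcfin hcF hcd hcc using hc
  have hf : ∀ e, ∃ f : ℤ × ℤ → ZMod 2, (∃ Q : Set (ℤ × ℤ), Q.Finite ∧ ∃ s, ∀ t ∉ Q, f t = s) ∧
      (∀ t, f t ≠ 0 → e.card = k - 2 ∧ ∀ i ∈ e, t ∈ squaresIn (B i)ᶜ) ∧ d₂ f = bd c e := fun e => by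
    by_cases h : bd c e = 0
    · exact ⟨0, ⟨∅, by simp, 0, by simp⟩, by simp, by simp [h]⟩
    · obtain ⟨i, hi, h⟩ := exists_of_bd_ne_zero h
      have hcard := hcc _ h
      rw [Finset.card_insert_of_notMem hi] at hcard
      have hne : e.Nonempty := hpos e (k - 2) (by omega) (by omega)
      have heF : (bd c e).support ⊆ edgesIn (⋂ i ∈ e, F i) := fun x hx => by
        have hx : bd c e x ≠ 0 := hx
        rw [bd_apply] at hx
        obtain ⟨i, _, h⟩ := exists_of_bd_ne_zero hx
        have := hcF _ h
        have hsub := Set.biInter_subset_biInter_left (t := F) (Finset.subset_insert i e)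
        exact ⟨hsub this.1, hsub this.2⟩
      obtain ⟨x, hx⟩ := Function.support_nonempty_iff.2 h
      have hnerve : e ∈ nerve F := ⟨hne, _, Set.biInter_subset_biInter_left
        (Finset.subset_insert i e) (hcF _ hx).1⟩
      obtain ⟨f, h1, h2, h3⟩ := exists_d₂_eq_of_joined (A := ⋂ i ∈ e, F i) (B := ⋃ i ∈ e, B i)
        (fun x hx hxF => by
          obtain ⟨i, hi, hxi⟩ := Set.mem_iUnion₂.1 hx
          exact hBF i x hxi (Set.mem_iInter₂.1 hxF i hi))
        (hBc e hnerve) (finite_support_bd hcfin e) heF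
        (by rw [map_bd]; simp only [hcd]; exact bd_bd_cells P e)
      refine ⟨f, h1, fun t ht => ⟨by omega, fun i hi => ?_⟩, h3⟩
      have hsub : (⋃ i ∈ e, B i)ᶜ ⊆ (B i)ᶜ :=
        Set.compl_subset_compl.2 (Set.subset_biUnion_of_mem (u := B) hi)
      have := h2 ht
      exact ⟨hsub this.1, hsub this.2.1, hsub this.2.2.1, hsub this.2.2.2⟩
  choose f hfc hfB hfd using hf
  -- A 2-cycle of the grid is constant. It vanishes at a point of `B j` if `j ∈ κ`. For `κ = ∅` it
  -- vanishes because `f` lives on indices with `k - 2 ≥ 2` elements.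
  have hf0 : ∀ κ, bd f κ = 0 := fun κ => by
    have hd : d₂ (bd f κ) = 0 := by rw [map_bd]; simp only [hfd]; exact bd_bd_cells c κ
    rcases κ.eq_empty_or_nonempty with rfl | ⟨j, hj⟩
    · ext t
      rw [bd_apply]
      by_contra h
      obtain ⟨i, hi, h⟩ := exists_of_bd_ne_zero h
      have := (hfB _ t h).1
      simp at this
      omega
    · obtain ⟨x, hx⟩ := hB j
      have h0 : bd f κ x = 0 := by
        rw [bd_apply]
        by_contra h
        obtain ⟨i, hi, h⟩ := exists_of_bd_ne_zero h
        exact ((hfB _ x h).2 j (Finset.mem_insert_of_mem hj)).1 hx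
      ext t
      rw [eq_const_of_d₂_eq_zero hd t x, h0, Pi.zero_apply]
  -- Ascent: `f = bd g`, `c + d₂ g = bd b` and `P + d₁ b = bd q`, now with supports avoiding the `B
  -- i` instead of inside the `F i`. The augmentation of `q` is the chain sought.
  obtain ⟨g, hgB, hgb, hgc, -⟩ := exists_bd_eq (R := fun i t => t ∈ squaresIn (B i)ᶜ)
    (k := k - 2) (by omega) hfB hf0
  -- Off the union of the exceptional sets all `f e` are constant, hence so is the pointwise filling
  -- `g ρ`.
  have hgfin : ∀ ρ, (d₂ (g ρ)).support.Finite := fun ρ => by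
    choose Q hQ s hs using hfc
    rcases Set.eq_empty_or_nonempty (⋃ e, Q e)ᶜ with h | ⟨t₀, ht₀⟩
    · exact finite_support_d₂ (Set.finite_iUnion hQ) (s := 0) fun t ht =>
        absurd (show t ∈ (⋃ e, Q e)ᶜ from ht) (h ▸ Set.notMem_empty t)
    · refine finite_support_d₂ (Set.finite_iUnion hQ) (s := g ρ t₀) fun t ht => hgc ρ t t₀ fun e => ?_
      rw [Set.mem_iUnion, not_exists] at ht
      rw [Set.mem_compl_iff, Set.mem_iUnion, not_exists] at ht₀
      rw [hs e t (ht e), hs e t₀ (ht₀ e)]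
  have hBF' : ∀ {ρ : Finset ι} {x}, x ∈ (⋂ i ∈ ρ, F i) → ∀ i ∈ ρ, x ∈ (B i)ᶜ :=
    fun hx i hi hxB => hBF i _ hxB (Set.mem_iInter₂.1 hx i hi)
  obtain ⟨b, hbB, hbb, -, hbfin⟩ := exists_bd_eq (R := fun i e => e ∈ edgesIn (B i)ᶜ)
    (k := k - 1) (by omega) (a := fun ρ => c ρ + d₂ (g ρ)) (fun ρ e h => by
      by_cases hce : c ρ e = 0
      · have h : d₂ (g ρ) e ≠ 0 := by simpa [hce] using h
        refine ⟨?_, fun i hi => ?_⟩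
        · have : g ρ ≠ 0 := fun h0 => h (by rw [h0, map_zero, Pi.zero_apply])
          obtain ⟨t, ht⟩ := Function.ne_iff.1 this
          have := (hgB ρ t ht).1
          omega
        · exact d₂_support (fun t ht => (hgB ρ t ht).2 i hi) h
      · refine ⟨?_, fun i hi => ?_⟩
        · have := hcc ρ (fun h0 => hce (by rw [h0, Pi.zero_apply]))
          omega
        · have := hcF ρ hce
          exact ⟨hBF' this.1 i hi, hBF' this.2 i hi⟩)
    (fun ρ => by
      have h := bd_add c (fun ρ => d₂ (g ρ)) ρ
      rw [← map_bd, hgb, hfd, CharTwo.add_self_eq_zero] at h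
      exact h)
  replace hbfin := finite_support_of_imp
    (fun ρ => finite_support_add (hcfin ρ) (hgfin ρ)) hbfin
  obtain ⟨q, hqB, hqb, -, hqfin⟩ := exists_bd_eq (R := fun i x => x ∈ (B i)ᶜ)
    (k := k) (by omega) (a := fun σ => P σ + d₁ (b σ)) (fun σ x h => by
      by_cases hPx : P σ x = 0
      · have h : d₁ (b σ) x ≠ 0 := by simpa [hPx] using h
        refine ⟨?_, fun i hi => ?_⟩
        · have : b σ ≠ 0 := fun h0 => h (by rw [h0, map_zero, Pi.zero_apply])
          obtain ⟨t, ht⟩ := Function.ne_iff.1 this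
          have := (hbB σ t ht).1
          omega
        · exact d₁_support (fun t ht => (hbB σ t ht).2 i hi) h
      · exact ⟨(hz σ (hPz σ x hPx)).2, hBF' (hPF σ hPx)⟩)
    (fun ρ => by
      have h := bd_add P (fun ρ => d₁ (b ρ)) ρ
      rw [← map_bd, hbb, map_add, d₁_d₂, hcd, add_zero, CharTwo.add_self_eq_zero] at h
      exact h)
  replace hqfin := finite_support_of_imp
    (fun σ => finite_support_add (hPfin σ) (finite_support_d₁ (hbfin σ))) hqfin
  refine ⟨fun κ => aug (q κ), fun κ h => ?_, fun σ => ?_⟩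
  · have : q κ ≠ 0 := fun h0 => h (by simp [h0, aug])
    obtain ⟨x, hx⟩ := Function.ne_iff.1 this
    have hx := hqB κ x hx
    have hne := hpos κ _ (by omega) hx.1
    exact ⟨⟨hne, hBn κ hne ⟨x, hx.2⟩⟩, hx.1⟩
  · rw [← aug_bd hqfin, hqb, aug_add (hPfin σ) (finite_support_d₁ (hbfin σ)), hPaug,
      aug_d₁ (hbfin σ), add_zero]

end Zigzag
-- Cutting a connected set along a separator.
section Splitting
variable {V : Type*} {G : SimpleGraph V} {A S D : Set V}

/-- A path can leave `D` only through `S`. So either it stays in `D`, or its part up to the first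
point of `S` lies in `S ∪ D`. -/
theorem JoinedInside.split (hD : ∀ x ∈ D, ∀ y, G.Adj x y → y ∉ S → y ∈ D) {x y : V}
    (h : JoinedInside G A x y) (hx : x ∈ A ∩ (S ∪ D)) :
    (JoinedInside G (A ∩ (S ∪ D)) x y ∧ y ∈ D) ∨
      ∃ s ∈ A ∩ S, JoinedInside G (A ∩ (S ∪ D)) x s := by
  by_cases hxS : x ∈ S
  · exact Or.inr ⟨x, ⟨hx.1, hxS⟩, Relation.ReflTransGen.refl⟩
  induction h with
  | refl => exact Or.inl ⟨Relation.ReflTransGen.refl, hx.2.resolve_left hxS⟩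
  | @tail y z _ hyz ih =>
    rcases ih with ⟨h, hy⟩ | h
    · by_cases hz : z ∈ S
      · exact Or.inr ⟨z, ⟨hyz.2.2, hz⟩, h.tail ⟨hyz.1, ⟨hyz.2.1, Or.inr hy⟩, hyz.2.2, Or.inl hz⟩⟩
      · have hzD := hD y hy z hyz.1 hz
        exact Or.inl ⟨h.tail ⟨hyz.1, ⟨hyz.2.1, Or.inr hy⟩, hyz.2.2, Or.inr hzD⟩, hzD⟩
    · exact Or.inr h

theorem ConnectedInside.split (hD : ∀ x ∈ D, ∀ y, G.Adj x y → y ∉ S → y ∈ D)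
    (hA : ConnectedInside G A) (hAS : ConnectedInside G (A ∩ S)) :
    ConnectedInside G (A ∩ (S ∪ D)) := by
  intro x hx y hy
  rcases (hA x hx.1 y hy.1).split hD hx with h | ⟨s, hs, h⟩
  · exact h.1
  rcases (hA y hy.1 x hx.1).split hD hy with h' | ⟨s', hs', h'⟩
  · exact h'.1.symm
  have hss := (hAS s hs s' hs').mono (B := A ∩ (S ∪ D))
    (Set.inter_subset_inter_right A Set.subset_union_left)
  exact (h.trans hss).trans h'.symm

end Splitting

/-! ### Nerves of families of connected sets in the grid. -/

section GridNerve
variable {ι : Type*} [Fintype ι] [DecidableEq ι]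

theorem cyclesBound_nerve_grid {k : ℕ} (hk : 4 ≤ k) {F : ι → Set (ℤ × ℤ)}
    (hfin : ∀ i, (F i).Finite)
    (hF : ∀ σ : Finset ι, σ.Nonempty → ConnectedInside grid (⋂ i ∈ σ, F i)) :
    CyclesBound {σ | σ ∈ nerve F} k := by
  induction hn : (⋃ i, F i).ncard using Nat.strong_induction_on generalizing F with
  | _ n ih =>
  subst hn
  by_cases hcone : ∃ i, ∀ j, F j ⊆ F i
  · obtain ⟨i, hi⟩ := hcone
    refine CyclesBound.of_cone i fun τ ⟨⟨j, hj⟩, x, hx⟩ => ⟨Finset.insert_nonempty _ _, x, ?_⟩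
    rw [Finset.set_biInter_insert]
    exact ⟨hi j (Set.mem_iInter₂.1 hx j hj), hx⟩
  push Not at hcone
  by_cases hirr : ∀ σ ∈ nerve F, ∀ x ∈ ⋃ i, F i, x ∉ (⋂ i ∈ σ, F i) → ∀ y ∈ ⋃ i, F i,
      y ∉ (⋂ i ∈ σ, F i) → JoinedInside grid (⋂ i ∈ σ, F i)ᶜ x y
  -- `B i` is the union of the components of the complement of `F i` that meet `⋃ i, F i`. It is
  -- non-empty because no member contains all the others.
  · let B : ι → Set (ℤ × ℤ) := fun i =>
      {x | ∃ w ∈ ⋃ i, F i, w ∉ F i ∧ JoinedInside grid (F i)ᶜ w x}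
    have hBself : ∀ i, ∀ w ∈ ⋃ i, F i, w ∉ F i → w ∈ B i := fun i w hw hwi =>
      ⟨w, hw, hwi, Relation.ReflTransGen.refl⟩
    have hBne : ∀ i, (B i).Nonempty := fun i => by
      obtain ⟨j, hj⟩ := hcone i
      obtain ⟨w, hw, hwi⟩ := Set.not_subset.1 hj
      exact ⟨w, hBself i w (Set.mem_iUnion.2 ⟨j, hw⟩) hwi⟩
    refine cyclesBound_nerve_of_complements hk hF hBne
      (fun i x ⟨w, _, hwi, h⟩ => h.mem (A := (F i)ᶜ) hwi) ?_ ?_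
    · intro σ hσ x hx y hy
      obtain ⟨i, hi, w, hw, hwi, h⟩ := Set.mem_iUnion₂.1 hx
      obtain ⟨j, hj, w', hw', hwj, h'⟩ := Set.mem_iUnion₂.1 hy
      have hsub : ∀ i ∈ σ, (F i)ᶜ ⊆ (⋂ i ∈ σ, F i)ᶜ := fun i hi =>
        Set.compl_subset_compl.2 (Set.biInter_subset_of_mem (t := F) hi)
      exact ((h.symm.mono (hsub i hi)).trans
        (hirr σ hσ w hw (hsub i hi hwi) w' hw' (hsub j hj hwj))).trans (h'.mono (hsub j hj))
    · rintro σ ⟨i₀, hi₀⟩ ⟨x, hx⟩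
      by_contra hne
      rw [Set.not_nonempty_iff_eq_empty] at hne
      -- If the `F i`, `i ∈ σ`, had no common point, then `⋃ i ∈ σ, B i` would be closed under
      -- adjacency: a neighbour of `B i` is in `B i` or in `F i`, and in the latter case it is
      -- missed by some other `F j`, hence lies in `B j`.
      have huniv : ⋃ i ∈ σ, B i = Set.univ := by
        refine grid_eq_univ ?_ fun x hx y hxy => ?_
        · obtain ⟨x, hx⟩ := hBne i₀
          exact ⟨x, Set.mem_biUnion (t := B) hi₀ hx⟩
        · obtain ⟨i, hi, w, hw, hwi, h⟩ := Set.mem_iUnion₂.1 hx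
          by_cases hy : y ∈ F i
          · have : y ∉ ⋂ i ∈ σ, F i := hne ▸ Set.notMem_empty y
            simp only [Set.mem_iInter, not_forall] at this
            obtain ⟨j, hj, hyj⟩ := this
            exact Set.mem_biUnion (t := B) hj (hBself j y (Set.mem_iUnion.2 ⟨i, hy⟩) hyj)
          · exact Set.mem_biUnion (t := B) hi ⟨w, hw, hwi, h.tail ⟨hxy, h.mem (A := (F i)ᶜ) hwi, hy⟩⟩
      obtain ⟨i, hi, hxi⟩ := Set.mem_iUnion₂.1 (huniv.ge (Set.mem_univ x))
      exact hx i hi hxi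
  · push Not at hirr
    obtain ⟨σ, ⟨⟨m, hm⟩, hσne⟩, w₁, hw₁, hw₁S, w₂, hw₂, hw₂S, hnot⟩ := hirr
    set S : Set (ℤ × ℤ) := ⋂ i ∈ σ, F i with hS
    let B : Set (ℤ × ℤ) := {x | JoinedInside grid Sᶜ w₁ x}
    have hBS : ∀ x ∈ B, x ∉ S := fun x hx => JoinedInside.mem (A := Sᶜ) hx hw₁S
    have hB : ∀ x ∈ B, ∀ y, grid.Adj x y → y ∉ S → y ∈ B := fun x hx y hxy hy =>
      Relation.ReflTransGen.tail hx ⟨hxy, hBS x hx, hy⟩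
    have hD : ∀ x ∈ (S ∪ B)ᶜ, ∀ y, grid.Adj x y → y ∉ S → y ∈ (S ∪ B)ᶜ := fun x hx y hxy hy hyB =>
      hx (Or.inr (hB y (hyB.resolve_left hy) x hxy.symm fun h => hx (Or.inl h)))
    have hinter : ∀ (T : Set (ℤ × ℤ)) (τ : Finset ι), τ.Nonempty →
        ⋂ i ∈ τ, F i ∩ T = (⋂ i ∈ τ, F i) ∩ T := fun T τ hτ => Set.biInter_inter hτ F T
    -- Cutting down to `S ∪ T` loses the point `w`, so induction applies. Intersections stay
    -- connected because `F_τ ∩ S` is itself the intersection over `τ ∪ σ`.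
    have hpart : ∀ T : Set (ℤ × ℤ), (∀ x ∈ T, ∀ y, grid.Adj x y → y ∉ S → y ∈ T) →
        (∃ w ∈ ⋃ i, F i, w ∉ S ∪ T) → CyclesBound {τ | τ ∈ nerve fun i => F i ∩ (S ∪ T)} k := by
      rintro T hT ⟨w, hw, hwT⟩
      refine ih _ (Set.ncard_lt_ncard ?_ (Set.finite_iUnion hfin))
        (fun i => (hfin i).inter_of_left _) (fun τ hτ => ?_) rfl
      · refine (Set.ssubset_iff_of_subset (Set.iUnion_mono fun i => Set.inter_subset_left)).2
          ⟨w, hw, fun h => ?_⟩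
        obtain ⟨i, hi⟩ := Set.mem_iUnion.1 h
        exact hwT hi.2
      · rw [hinter _ _ hτ]
        refine (hF τ hτ).split hT ?_
        have := hF (τ ∪ σ) (hτ.mono Finset.subset_union_left)
        rwa [show ⋂ i ∈ τ ∪ σ, F i = (⋂ i ∈ τ, F i) ∩ S by
          ext x; simp [hS, or_imp, forall_and]] at this
    have hmem : ∀ (T : Set (ℤ × ℤ)) (τ : Finset ι), τ ∈ nerve (fun i => F i ∩ T) ↔
        τ.Nonempty ∧ ((⋂ i ∈ τ, F i) ∩ T).Nonempty := fun T τ => by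
      change (_ ∧ _) ↔ _
      exact and_congr_right fun h => by rw [hinter T τ h]
    have hface : ∀ T : Set (ℤ × ℤ), ∀ τ ∈ nerve (fun i => F i ∩ T), ∀ i ∈ τ, τ.card = k →
        τ.erase i ∈ nerve (fun i => F i ∩ T) := fun T τ hτ i hi hc =>
      ((nerve _).isRelLowerSet_faces hτ).2 (Finset.erase_subset i τ) (Finset.card_pos.1 (by
        have := Finset.card_erase_add_one hi
        omega))
    refine CyclesBound.union m ?_ ?_ (hface (S ∪ B)) (hface (S ∪ (S ∪ B)ᶜ))
      (hpart B hB ⟨w₂, hw₂, fun h => h.elim hw₂S hnot⟩)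
      (hpart (S ∪ B)ᶜ hD ⟨w₁, hw₁, fun h => h.elim hw₁S fun h =>
        h (Or.inr Relation.ReflTransGen.refl)⟩)
    · ext τ
      change _ ↔ τ ∈ nerve (fun i => F i ∩ (S ∪ B)) ∨ τ ∈ nerve (fun i => F i ∩ (S ∪ (S ∪ B)ᶜ))
      rw [hmem, hmem, ← and_or_left, ← Set.union_nonempty, ← Set.inter_union_distrib_left,
        show S ∪ B ∪ (S ∪ (S ∪ B)ᶜ) = Set.univ from Set.eq_univ_of_forall fun x => by
        by_cases hx : x ∈ S ∪ B
        · exact Or.inl hx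
        · exact Or.inr (Or.inr hx), Set.inter_univ]
      rfl
    -- If `F_τ` meets both sides, a path inside it crosses `S`. Since `S ⊆ F m`, the index `m` can
    -- be added to `τ`.
    · rintro τ ⟨h₁, h₂⟩
      obtain ⟨hτ, x, hx⟩ := (hmem _ _).1 h₁
      obtain ⟨-, y, hy⟩ := (hmem _ _).1 h₂
      obtain ⟨s, hs⟩ : ((⋂ i ∈ τ, F i) ∩ S).Nonempty := by
        rcases (hF τ hτ x hx.1 y hy.1).split hB hx with ⟨-, hyB⟩ | ⟨s, hs, -⟩
        · exact absurd hy.2 (fun h => h.elim (hBS y hyB) fun h => h (Or.inr hyB))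
        · exact ⟨s, hs⟩
      have hs' : s ∈ ⋂ i ∈ insert m τ, F i := by
        rw [Finset.set_biInter_insert]
        exact ⟨Set.mem_iInter₂.1 hs.2 m hm, hs.1⟩
      exact ⟨(hmem _ _).2 ⟨Finset.insert_nonempty _ _, s, hs', Or.inl hs.2⟩,
        (hmem _ _).2 ⟨Finset.insert_nonempty _ _, s, hs', Or.inl hs.2⟩⟩

end GridNerve
-- Approximating plane sets by grid points.
section Pixels
open Filter Topology

/-- The points of the grid of mesh `ε` at distance less than `ε` from `K`, in the sup norm. -/
def pixels (ε : ℝ) (K : Set (EuclideanSpace ℝ (Fin 2))) : Set (ℤ × ℤ) :=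
  {g | ∃ q ∈ K, |ε * g.1 - q 0| < ε ∧ |ε * g.2 - q 1| < ε}

variable {ε : ℝ} {K L : Set (EuclideanSpace ℝ (Fin 2))}

theorem pixels_mono (h : K ⊆ L) : pixels ε K ⊆ pixels ε L := fun _ ⟨q, hq, hg⟩ => ⟨q, h hq, hg⟩

theorem pixels_nonempty (hε : 0 < ε) (hK : K.Nonempty) : (pixels ε K).Nonempty := by
  obtain ⟨q, hq⟩ := hK
  have h : ∀ x : ℝ, |ε * ⌊x / ε⌋ - x| < ε := fun x => by
    have h1 := Int.floor_le (x / ε)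
    have h2 := Int.lt_floor_add_one (x / ε)
    rw [le_div_iff₀ hε] at h1
    rw [div_lt_iff₀ hε] at h2
    rw [abs_lt]
    constructor <;> nlinarith
  exact ⟨(⌊q 0 / ε⌋, ⌊q 1 / ε⌋), q, hq, h _, h _⟩

theorem pixels_finite (hε : 0 < ε) (hK : Bornology.IsBounded K) : (pixels ε K).Finite := by
  obtain ⟨R, hR⟩ := hK.exists_norm_le
  have h : ∀ (a : ℤ) (x : ℝ), |x| ≤ R → |ε * a - x| < ε → a ∈ Set.Icc (-⌈R / ε + 1⌉) ⌈R / ε + 1⌉ := by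
    intro a x hx ha
    have h1 : |ε * a| ≤ R + ε := by
      calc |ε * a| = |(ε * a - x) + x| := by ring_nf
        _ ≤ |ε * a - x| + |x| := abs_add_le _ _
        _ ≤ R + ε := by linarith
    rw [abs_mul, abs_of_pos hε] at h1
    have h2 : (|a| : ℝ) ≤ R / ε + 1 := by
      rw [← sub_le_iff_le_add, le_div_iff₀ hε]
      linarith
    have h3 : |a| ≤ ⌈R / ε + 1⌉ := by exact_mod_cast h2.trans (Int.le_ceil _)
    exact abs_le.1 h3
  refine ((Set.finite_Icc (-⌈R / ε + 1⌉) ⌈R / ε + 1⌉).prod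
    (Set.finite_Icc (-⌈R / ε + 1⌉) ⌈R / ε + 1⌉)).subset ?_
  rintro ⟨a, b⟩ ⟨q, hq, h1, h2⟩
  have hn : ∀ i, |q i| ≤ R := fun i =>
    (Real.norm_eq_abs (q i) ▸ PiLp.norm_apply_le q i).trans (hR q hq)
  exact ⟨h a _ (hn 0) h1, h b _ (hn 1) h2⟩

/-- A shared pixel puts the two points within `2ε` in each coordinate, so at Euclidean distance
below `2√2 ε`, less than `4ε`. -/
theorem pixels_disjoint (h : ∀ q ∈ K, ∀ q' ∈ L, 4 * ε < dist q q') :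
    Disjoint (pixels ε K) (pixels ε L) := by
  rw [Set.disjoint_left]
  rintro g ⟨q, hq, h1, h2⟩ ⟨q', hq', h1', h2'⟩
  have hd := h q hq q' hq'
  have hx : |q 0 - q' 0| < 2 * ε := by
    rw [abs_lt] at *; constructor <;> linarith
  have hy : |q 1 - q' 1| < 2 * ε := by
    rw [abs_lt] at *; constructor <;> linarith
  have hε : 0 < ε := by linarith [abs_nonneg (q 0 - q' 0)]
  rw [EuclideanSpace.dist_eq, Fin.sum_univ_two, Real.lt_sqrt (by positivity), Real.dist_eq,
    Real.dist_eq] at hd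
  nlinarith [abs_nonneg (q 0 - q' 0), abs_nonneg (q 1 - q' 1)]

theorem pixels_connectedInside_singleton (q : EuclideanSpace ℝ (Fin 2)) :
    ConnectedInside grid (pixels ε {q}) := by
  have hmem : ∀ a b : ℤ, (a, b) ∈ pixels ε {q} ↔ |ε * a - q 0| < ε ∧ |ε * b - q 1| < ε := by
    simp [pixels]
  have hclose : ∀ (x : ℝ) (a a' : ℤ), |ε * a - x| < ε → |ε * a' - x| < ε →
      a = a' ∨ a = a' + 1 ∨ a' = a + 1 := by
    intro x a a' h h'
    have hε : 0 < ε := (abs_nonneg _).trans_lt h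
    rw [abs_lt] at h h'
    have h1 : (a : ℝ) < a' + 2 := by nlinarith
    have h2 : (a' : ℝ) < a + 2 := by nlinarith
    norm_cast at h1 h2
    omega
  rintro ⟨a, b⟩ hx ⟨a', b'⟩ hy
  obtain ⟨h1, h2⟩ := (hmem a b).1 hx
  obtain ⟨h1', h2'⟩ := (hmem a' b').1 hy
  have hz : (a', b) ∈ pixels ε {q} := (hmem a' b).2 ⟨h1', h2⟩
  have hxz : JoinedInside grid (pixels ε {q}) (a, b) (a', b) := by
    rcases hclose _ a a' h1 h1' with rfl | h
    · exact Relation.ReflTransGen.refl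
    · exact Relation.ReflTransGen.single ⟨Or.inr ⟨rfl, h⟩, hx, hz⟩
  refine hxz.trans ?_
  rcases hclose _ b b' h2 h2' with rfl | h
  · exact Relation.ReflTransGen.refl
  · exact Relation.ReflTransGen.single ⟨Or.inl ⟨rfl, h⟩, hz, hy⟩

/-- The open squares of side `2ε` about the pixels cover `K`. If the pixels split into two unjoined
classes, the two unions of squares would meet in a point `r` of `K`, but the pixels of a single
point are joined. -/
theorem pixels_connectedInside (hε : 0 < ε) (hK : IsPreconnected K) :
    ConnectedInside grid (pixels ε K) := by
  rintro g hg g' hg'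
  by_contra hnot
  let O : ℤ × ℤ → Set (EuclideanSpace ℝ (Fin 2)) := fun g =>
    {q | |ε * g.1 - q 0| < ε ∧ |ε * g.2 - q 1| < ε}
  have hO : ∀ g, IsOpen (O g) := fun g => by
    refine IsOpen.and (isOpen_lt ?_ continuous_const) (isOpen_lt ?_ continuous_const) <;> fun_prop
  let P : ℤ × ℤ → Prop := fun x => JoinedInside grid (pixels ε K) g x
  obtain ⟨q, hq, hqg⟩ := hg
  obtain ⟨q', hq', hqg'⟩ := hg'
  obtain ⟨r, hr, hr1, hr2⟩ := hK (⋃ x ∈ {x | P x}, O x) (⋃ x ∈ {x | ¬ P x}, O x)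
    (isOpen_biUnion fun x _ => hO x) (isOpen_biUnion fun x _ => hO x)
    (fun p hp => by
      obtain ⟨x, p', hp', hx⟩ := pixels_nonempty hε (Set.singleton_nonempty p)
      rw [Set.mem_singleton_iff.1 hp'] at hx
      by_cases hPx : P x
      · exact Or.inl (Set.mem_biUnion (t := O) hPx hx)
      · exact Or.inr (Set.mem_biUnion (t := O) hPx hx))
    ⟨q, hq, Set.mem_biUnion (t := O) (show P g from Relation.ReflTransGen.refl) hqg⟩
    ⟨q', hq', Set.mem_biUnion (t := O) (show ¬ P g' from hnot) hqg'⟩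
  obtain ⟨x, hx, hxr⟩ := Set.mem_iUnion₂.1 hr1
  obtain ⟨y, hy, hyr⟩ := Set.mem_iUnion₂.1 hr2
  refine hy (Relation.ReflTransGen.trans hx ?_)
  exact (pixels_connectedInside_singleton r x ⟨r, rfl, hxr⟩ y ⟨r, rfl, hyr⟩).mono
    (pixels_mono (Set.singleton_subset_iff.2 hr))

theorem eventually_lt_dist {X : Type*} [MetricSpace X] {K L : Set X} (hK : IsCompact K)
    (hL : IsCompact L) (h : Disjoint K L) :
    ∀ᶠ r : ℝ in 𝓝[>] 0, ∀ q ∈ K, ∀ q' ∈ L, 4 * r < dist q q' := by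
  obtain ⟨δ, hδ, h⟩ := Metric.exists_pos_forall_lt_edist hK hL.isClosed h
  have hδ' : (0 : ℝ) < δ / 4 := by positivity
  filter_upwards [Ioo_mem_nhdsGT hδ'] with r hr q hq q' hq'
  have h2 := h q hq q' hq'
  rw [edist_dist, ENNReal.lt_ofReal_iff_toReal_lt ENNReal.coe_ne_top, ENNReal.coe_toReal] at h2
  linarith [hr.2]

end Pixels

/-! ### Planar graphs as minors of the grid. -/

section Model
variable {V : Type*} {G : SimpleGraph V}

theorem JoinedInside.joined_component {A : Set V} {x y : V} (h : JoinedInside G A x y) :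
    JoinedInside G {z | JoinedInside G A x z} x y := by
  induction h with
  | refl => exact Relation.ReflTransGen.refl
  | tail h h' ih => exact ih.tail ⟨h'.1, h, h.tail h'⟩

namespace PlaneDrawing

theorem arc_spec (D : PlaneDrawing G) {u v : V} (h : G.Adj u v) :
    IsCompact (D.arc ⟨s(u, v), h⟩) ∧ IsPreconnected (D.arc ⟨s(u, v), h⟩) ∧
      D.point u ∈ D.arc ⟨s(u, v), h⟩ ∧ D.point v ∈ D.arc ⟨s(u, v), h⟩ := by
  obtain ⟨p, -, hp⟩ := D.exists_path u v h
  rw [← hp]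
  exact ⟨isCompact_range p.continuous, isPreconnected_range p.continuous, ⟨0, p.source⟩,
    ⟨1, p.target⟩⟩

open Filter Topology in
/-- A graph drawn in the plane is a minor of the grid. -/
theorem exists_grid_model [Finite V] (D : PlaneDrawing G) :
    ∃ S : V → Set (ℤ × ℤ), (∀ v, (S v).Finite ∧ (S v).Nonempty ∧ ConnectedInside grid (S v)) ∧
      (∀ u v, u ≠ v → Disjoint (S u) (S v)) ∧
      ∀ u v, G.Adj u v → ∃ x ∈ S u, ∃ y ∈ S v, grid.Adj x y := by
  have hends : ∀ e : G.edgeSet, ∃ t h : V, s(t, h) = (e : Sym2 V) ∧ G.Adj t h := by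
    rintro ⟨e, he⟩
    induction e using Sym2.ind with
    | _ t h => exact ⟨t, h, rfl, he⟩
  choose tl hd htl hadj using hends
  have harc : ∀ e, IsCompact (D.arc e) ∧ IsPreconnected (D.arc e) ∧ D.point (tl e) ∈ D.arc e ∧
      D.point (hd e) ∈ D.arc e := fun e => by
    have := D.arc_spec (hadj e)
    rwa [show (⟨s(tl e, hd e), hadj e⟩ : G.edgeSet) = e from Subtype.ext (htl e)] at this
  have hmem : ∀ (e : G.edgeSet) w, w ∈ (e : Sym2 V) → w = tl e ∨ w = hd e := fun e w hw => by
    rwa [← htl e, Sym2.mem_iff] at hw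
  have hne : ∀ e, tl e ≠ hd e := fun e => (hadj e).ne
  -- The closed discs of radius `r` about the vertices are pairwise disjoint and miss all
  -- non-incident arcs.
  obtain ⟨r, hr0, hr₁, hr₂⟩ : ∃ r : ℝ, 0 < r ∧
      (∀ u v, u ≠ v → 4 * r < dist (D.point u) (D.point v)) ∧
      ∀ (e : G.edgeSet) w, w ∉ (e : Sym2 V) → ∀ q ∈ D.arc e, 4 * r < dist q (D.point w) := by
    refine ((eventually_mem_nhdsWithin (a := (0 : ℝ)) (s := Set.Ioi 0)).and
      (Eventually.and (eventually_all.2 fun u => eventually_all.2 fun v => ?_)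
      (eventually_all.2 fun e => eventually_all.2 fun w => ?_))).exists
    · by_cases h : u = v
      · exact Eventually.of_forall fun _ h' => absurd h h'
      · filter_upwards [eventually_lt_dist (isCompact_singleton (x := D.point u))
          (isCompact_singleton (x := D.point v)) (by simpa using fun h' => h (D.point_injective h'))]
          with r hr _ using hr _ rfl _ rfl
    · by_cases h : w ∈ (e : Sym2 V)
      · exact Eventually.of_forall fun _ h' => absurd h h'
      · filter_upwards [eventually_lt_dist (harc e).1 (isCompact_singleton (x := D.point w))
          (by simpa using fun h' => h (D.vertex_on_arc e w h'))] with r hr _ q hq using hr q hq _ rfl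
  -- The mesh must also separate arcs with different tails, once the disc about each head is
  -- removed. Such arcs are then disjoint, since a common end is the head of one of them.
  obtain ⟨ε, hε, hε₁, hε₂, hε₃⟩ : ∃ ε : ℝ, 0 < ε ∧
      (∀ u v, u ≠ v → ∀ q ∈ Metric.closedBall (D.point u) r,
        ∀ q' ∈ Metric.closedBall (D.point v) r, 4 * ε < dist q q') ∧
      (∀ (e : G.edgeSet) w, w ∉ (e : Sym2 V) → ∀ q ∈ D.arc e,
        ∀ q' ∈ Metric.closedBall (D.point w) r, 4 * ε < dist q q') ∧
      ∀ e f : G.edgeSet, tl e ≠ tl f → ∀ q ∈ D.arc e \ Metric.ball (D.point (hd e)) r,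
        ∀ q' ∈ D.arc f \ Metric.ball (D.point (hd f)) r, 4 * ε < dist q q' := by
    refine ((eventually_mem_nhdsWithin (a := (0 : ℝ)) (s := Set.Ioi 0)).and
      (Eventually.and (eventually_all.2 fun u => eventually_all.2 fun v => ?_)
      (Eventually.and (eventually_all.2 fun e => eventually_all.2 fun w => ?_)
      (eventually_all.2 fun e => eventually_all.2 fun f => ?_)))).exists
    · by_cases h : u = v
      · exact Eventually.of_forall fun _ h' => absurd h h'
      · filter_upwards [eventually_lt_dist (isCompact_closedBall (D.point u) r)
          (isCompact_closedBall (D.point v) r) (Metric.closedBall_disjoint_closedBall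
            (by linarith [hr₁ u v h]))] with ε h _ using h
    · by_cases h : w ∈ (e : Sym2 V)
      · exact Eventually.of_forall fun _ h' => absurd h h'
      · filter_upwards [eventually_lt_dist (harc e).1 (isCompact_closedBall (D.point w) r)
          (Set.disjoint_left.2 fun q hq hq' => by
            have := hr₂ e w h q hq
            rw [Metric.mem_closedBall] at hq'
            linarith)] with ε h _ using h
    · by_cases h : tl e = tl f
      · exact Eventually.of_forall fun _ h' => absurd h h'
      · filter_upwards [eventually_lt_dist ((harc e).1.diff Metric.isOpen_ball)
          ((harc f).1.diff Metric.isOpen_ball) (Set.disjoint_left.2 fun q hq hq' => by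
            obtain ⟨w, ⟨hwe, hwf⟩, rfl⟩ := D.arcs_meet e f (fun h' => h (h' ▸ rfl)) ⟨hq.1, hq'.1⟩
            rcases hmem e w hwe with h₁ | h₁
            · rcases hmem f w hwf with h₂ | h₂
              · exact h (h₁.symm.trans h₂)
              · exact hq'.2 (by rw [h₂]; exact Metric.mem_ball_self hr0)
            · exact hq.2 (by rw [h₁]; exact Metric.mem_ball_self hr0))] with ε h _ using h
  let b : V → Set (ℤ × ℤ) := fun u => pixels ε (Metric.closedBall (D.point u) r)
  have hcenter : ∀ u, D.point u ∈ Metric.closedBall (D.point u) r := fun u =>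
    Metric.mem_closedBall_self hr0.le
  have hsub : ∀ u, pixels ε {D.point u} ⊆ b u := fun u =>
    pixels_mono (Set.singleton_subset_iff.2 (hcenter u))
  have hbb : ∀ u v, u ≠ v → Disjoint (b u) (b v) := fun u v h => pixels_disjoint (hε₁ u v h)
  choose o ho using fun u => pixels_nonempty hε (Set.singleton_nonempty (D.point u))
  let P : G.edgeSet → Set (ℤ × ℤ) := fun e => pixels ε (D.arc e) \ b (hd e)
  have hoP : ∀ e, o (tl e) ∈ P e := fun e =>
    ⟨pixels_mono (Set.singleton_subset_iff.2 (harc e).2.2.1) (ho _),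
      Set.disjoint_left.1 (hbb _ _ (hne e)) (hsub _ (ho _))⟩
  -- The part of the pixelated arc reachable from its tail before entering the disc of its head. It
  -- joins the branch set of the tail, and the first step into the head's disc gives the required
  -- adjacency.
  let C : G.edgeSet → Set (ℤ × ℤ) := fun e => {g | JoinedInside grid (P e) (o (tl e)) g}
  have hCP : ∀ e, C e ⊆ P e := fun e g hg => JoinedInside.mem hg (hoP e)
  have hPfar : ∀ e, P e ⊆ pixels ε (D.arc e \ Metric.ball (D.point (hd e)) r) := by
    rintro e g ⟨⟨q, hq, hg⟩, hgb⟩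
    exact ⟨q, ⟨hq, fun hqb => hgb ⟨q, Metric.ball_subset_closedBall hqb, hg⟩⟩, hg⟩
  have hCb : ∀ e u, tl e ≠ u → Disjoint (C e) (b u) := fun e u h => by
    by_cases hu : u = hd e
    · subst hu
      exact Set.disjoint_left.2 fun g hg => (hCP e hg).2
    · refine (pixels_disjoint (hε₂ e u fun hue => ?_)).mono_left ((hCP e).trans Set.sdiff_subset)
      exact (hmem e u hue).elim (fun h' => h h'.symm) hu
  have hCC : ∀ e f, tl e ≠ tl f → Disjoint (C e) (C f) := fun e f h =>
    (pixels_disjoint (hε₃ e f h)).mono ((hCP e).trans (hPfar e)) ((hCP f).trans (hPfar f))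
  let S : V → Set (ℤ × ℤ) := fun u => b u ∪ ⋃ e ∈ {e | tl e = u}, C e
  have hCS : ∀ e, C e ⊆ S (tl e) := fun e =>
    (Set.subset_biUnion_of_mem (u := C) (show e ∈ {e' | tl e' = tl e} from rfl)).trans
      Set.subset_union_right
  have hcross : ∀ e, ∃ x ∈ S (tl e), ∃ y ∈ S (hd e), grid.Adj x y := fun e => by
    have key : ∀ g, JoinedInside grid (pixels ε (D.arc e)) (o (tl e)) g →
        g ∈ C e ∨ ∃ x ∈ S (tl e), ∃ y ∈ S (hd e), grid.Adj x y := fun g hg => by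
      induction hg with
      | refl => exact Or.inl Relation.ReflTransGen.refl
      | @tail x y _ hxy ih =>
        rcases ih with hx | h
        · by_cases hy : y ∈ b (hd e)
          · exact Or.inr ⟨x, hCS e hx, y, Or.inl hy, hxy.1⟩
          · exact Or.inl (Relation.ReflTransGen.tail hx ⟨hxy.1, hCP e hx, hxy.2.2, hy⟩)
        · exact Or.inr h
    have hoh := pixels_mono (ε := ε) (Set.singleton_subset_iff.2 (harc e).2.2.2) (ho (hd e))
    exact (key _ (pixels_connectedInside hε (harc e).2.1 _ (hoP e).1 _ hoh)).resolve_left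
      fun h => (hCP e h).2 (hsub _ (ho _))
  refine ⟨S, fun u => ⟨?_, ⟨o u, Or.inl (hsub u (ho u))⟩, ?_⟩, fun u v h => ?_, fun u v h => ?_⟩
  · refine (pixels_finite hε Metric.isBounded_closedBall).union
      (Set.Finite.biUnion (Set.toFinite _) fun e _ => ?_)
    exact (pixels_finite hε (harc e).1.isBounded).subset ((hCP e).trans Set.sdiff_subset)
  · have hjoin : ∀ x ∈ S u, JoinedInside grid (S u) (o u) x := by
      rintro x (hx | hx)
      · exact (pixels_connectedInside hε (convex_closedBall _ _).isPreconnected _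
          (hsub u (ho u)) _ hx).mono Set.subset_union_left
      · obtain ⟨e, he, hx'⟩ := Set.mem_iUnion₂.1 hx
        obtain rfl : tl e = u := he
        exact (JoinedInside.joined_component hx').mono (hCS e)
    exact fun x hx y hy => (hjoin x hx).symm.trans (hjoin y hy)
  · refine Set.disjoint_left.2 fun g hu hv => ?_
    rcases hu with hu | hu
    · rcases hv with hv | hv
      · exact Set.disjoint_left.1 (hbb u v h) hu hv
      · obtain ⟨e, he, hv'⟩ := Set.mem_iUnion₂.1 hv
        obtain rfl : tl e = v := he
        exact Set.disjoint_left.1 (hCb e u h.symm) hv' hu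
    · obtain ⟨e, he, hu'⟩ := Set.mem_iUnion₂.1 hu
      obtain rfl : tl e = u := he
      rcases hv with hv | hv
      · exact Set.disjoint_left.1 (hCb e v h) hu' hv
      · obtain ⟨f, hf, hv'⟩ := Set.mem_iUnion₂.1 hv
        obtain rfl : tl f = v := hf
        exact Set.disjoint_left.1 (hCC e f h) hu' hv'
  · obtain ⟨x, hx, y, hy, hxy⟩ := hcross ⟨s(u, v), h⟩
    have := htl ⟨s(u, v), h⟩
    rcases Sym2.eq_iff.1 this with ⟨h₁, h₂⟩ | ⟨h₁, h₂⟩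
    · exact ⟨x, h₁ ▸ hx, y, h₂ ▸ hy, hxy⟩
    · exact ⟨y, h₂ ▸ hy, x, h₁ ▸ hx, hxy.symm⟩

end PlaneDrawing
end Model
-- Transfer to planar graphs and the degree `-1`.
section Planar
variable {V : Type*} {G : SimpleGraph V}

/-- Disjoint branch sets make intersection commute with blowing up vertices: a grid point determines
its vertex. This preserves the nerve. -/
theorem mem_biInter_branch {ι : Type*} {S : V → Set (ℤ × ℤ)}
    (hS : ∀ u v, u ≠ v → Disjoint (S u) (S v)) (F : ι → Set V) {σ : Finset ι} (hσ : σ.Nonempty)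
    (g : ℤ × ℤ) : g ∈ (⋂ i ∈ σ, ⋃ v ∈ F i, S v) ↔ ∃ v ∈ ⋂ i ∈ σ, F i, g ∈ S v := by
  simp only [Set.mem_iInter, Set.mem_iUnion, exists_prop]
  constructor
  · intro h
    obtain ⟨i₀, hi₀⟩ := hσ
    obtain ⟨v, -, hg⟩ := h i₀ hi₀
    refine ⟨v, fun i hi => ?_, hg⟩
    obtain ⟨w, hw, hgw⟩ := h i hi
    have : v = w := by
      by_contra hne
      exact Set.disjoint_left.1 (hS v w hne) hg hgw
    exact this ▸ hw
  · rintro ⟨v, hv, hg⟩ i hi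
    exact ⟨v, hv i hi, hg⟩

theorem cyclesBound_nerve_of_isPlanar [Finite V] (hG : IsPlanar G) {ι : Type*} [Fintype ι]
    [DecidableEq ι] {F : ι → Set V} (hF : IsConnectedCover G F) {k : ℕ} (hk : 4 ≤ k) :
    CyclesBound {σ | σ ∈ nerve F} k := by
  obtain ⟨D⟩ := hG
  obtain ⟨S, hS, hdisj, hadj⟩ := D.exists_grid_model
  have hinter := fun (σ : Finset ι) hσ g => mem_biInter_branch hdisj F (σ := σ) hσ g
  have hnerve : {σ | σ ∈ nerve F} = {σ | σ ∈ nerve fun i => ⋃ v ∈ F i, S v} := by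
    ext σ
    refine and_congr_right fun hσ => ?_
    constructor
    · rintro ⟨v, hv⟩
      obtain ⟨g, hg⟩ := (hS v).2.1
      exact ⟨g, (hinter σ hσ g).2 ⟨v, hv, hg⟩⟩
    · rintro ⟨g, hg⟩
      obtain ⟨v, hv, -⟩ := (hinter σ hσ g).1 hg
      exact ⟨v, hv⟩
  rw [hnerve]
  refine cyclesBound_nerve_grid hk (fun i => Set.Finite.biUnion (Set.toFinite _) fun v _ => (hS v).1)
    fun σ hσ g hg g' hg' => ?_
  obtain ⟨v, hv, hgv⟩ := (hinter σ hσ g).1 hg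
  obtain ⟨w, hw, hgw⟩ := (hinter σ hσ g').1 hg'
  have hsub : ∀ u ∈ ⋂ i ∈ σ, F i, S u ⊆ ⋂ i ∈ σ, ⋃ v ∈ F i, S v := fun u hu x hx =>
    (hinter σ hσ x).2 ⟨u, hu, hx⟩
  have hreach := (hF.connected σ ⟨hσ, v, hv⟩).preconnected ⟨v, hv⟩ ⟨w, hw⟩
  rw [SimpleGraph.reachable_iff_reflTransGen] at hreach
  -- A path in the induced subgraph is lifted by crossing between branch sets along grid edges and
  -- moving inside each of them.
  suffices h : ∀ u : ↥(⋂ i ∈ σ, F i), Relation.ReflTransGen (G.induce (⋂ i ∈ σ, F i)).Adj ⟨v, hv⟩ u →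
      ∀ x ∈ S u, JoinedInside grid (⋂ i ∈ σ, ⋃ v ∈ F i, S v) g x from h _ hreach g' hgw
  intro u hu
  induction hu with
  | refl => exact fun x hx => ((hS v).2.2 g hgv x hx).mono (hsub v hv)
  | @tail a b _ hab ih =>
    intro x hx
    obtain ⟨y, hy, z, hz, hyz⟩ := hadj a b hab
    exact ((ih y hy).tail ⟨hyz, hsub a a.2 hy, hsub b b.2 hz⟩).trans
      (((hS b).2.2 z hz x hx).mono (hsub b b.2))

theorem neg_one_mem_nonvanishingDegrees (G : SimpleGraph V) : (-1 : ℤ) ∈ nonvanishingDegrees G := by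
  refine ⟨0, fun i => i.elim0, ⟨fun i => i.elim0, fun σ hσ => ?_⟩, ?_⟩
  · obtain ⟨i, -⟩ := hσ.1
    exact i.elim0
  · have hK : ∀ σ : Finset (Fin 0), σ ∉ nerve (fun i : Fin 0 => (i.elim0 : Set V)) := fun σ hσ => by
      obtain ⟨i, -⟩ := hσ.1
      exact i.elim0
    refine QuotientAddGroup.nontrivial_iff.2 fun h => ?_
    have hmem : Finsupp.single ∅ 1 ∈ cycles (nerve (fun i : Fin 0 => (i.elim0 : Set V))) (-1) :=
      ⟨Finsupp.single_mem_supported _ _ ⟨Or.inl rfl, by simp⟩, by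
        rw [SetLike.mem_coe, LinearMap.mem_ker, boundary_single]; simp⟩
    have h1 : (⟨Finsupp.single ∅ 1, hmem⟩ :
        (cycles (nerve (fun i : Fin 0 => (i.elim0 : Set V))) (-1)).toAddSubgroup) ∈
        (boundaries (nerve (fun i : Fin 0 => (i.elim0 : Set V))) (-1)).toAddSubgroup.addSubgroupOf
        (cycles (nerve (fun i : Fin 0 => (i.elim0 : Set V))) (-1)).toAddSubgroup := by
      rw [h]; trivial
    rw [AddSubgroup.mem_addSubgroupOf] at h1
    obtain ⟨c, hc, hcb⟩ := h1
    have hc0 : c = 0 := by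
      rw [← Finsupp.support_eq_empty, Finset.eq_empty_iff_forall_notMem]
      intro σ hσ
      have := (Finsupp.mem_supported _ _).1 hc hσ
      rcases this.1 with rfl | h2
      · simpa using this.2
      · exact hK σ h2
    rw [hc0, map_zero] at hcb
    have := DFunLike.congr_fun hcb ∅
    simp at this

end Planar
end ConnectedCover

theorem mainTheorem3 {V : Type*} [Finite V] (G : SimpleGraph V)
    (hG : ConnectedCover.IsPlanar G) :
    (IsGreatest (ConnectedCover.nonvanishingDegrees G) (ConnectedCover.homologicalDimension G) ∧
      ConnectedCover.homologicalDimension G ≤ 2) ∧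
    ∀ (n : ℕ) (F : Fin n → Set V), ConnectedCover.IsConnectedCover G F →
      Subsingleton (ConnectedCover.ReducedHomology (ConnectedCover.nerve F) 3) := by
  have hvanish : ∀ d : ℤ, 3 ≤ d → ∀ (n : ℕ) (F : Fin n → Set V),
      ConnectedCover.IsConnectedCover G F →
      Subsingleton (ConnectedCover.ReducedHomology (ConnectedCover.nerve F) d) :=
    fun d hd n F hF => ConnectedCover.subsingleton_reducedHomology (k := (d + 1).toNat) (by omega)
      (by omega) (ConnectedCover.cyclesBound_nerve_of_isPlanar hG hF (by omega))
  have hle : ∀ d ∈ ConnectedCover.nonvanishingDegrees G, d ≤ 2 := by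
    rintro d ⟨n, F, hF, hnt⟩
    by_contra hd
    exact not_subsingleton_iff_nontrivial.2 hnt (hvanish d (by omega) n F hF)
  have hne : (ConnectedCover.nonvanishingDegrees G).Nonempty :=
    ⟨-1, ConnectedCover.neg_one_mem_nonvanishingDegrees G⟩
  have hmem : ConnectedCover.homologicalDimension G ∈ ConnectedCover.nonvanishingDegrees G :=
    Int.csSup_mem hne ⟨2, hle⟩
  exact ⟨⟨⟨hmem, fun d hd => le_csSup ⟨2, hle⟩ hd⟩, hle _ hmem⟩, hvanish 3 le_rfl⟩
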